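/- Let $k$ be a positive even integer. A Hecke cusp form of weight $k$ for $SL(2,\mathbb{Z})$ is a holomorphic cusp form $f$ of weight $k$ for $SL(2,\mathbb{Z})$ which is an eigenfunction of all the Hecke operators $$(T_n f)(z)=n^{k-1}\sum_{ad=n}d^{-k}\sum_{0\le b<d} f\Big(\frac{az+b}{d}\Big)\qquad (n\ge 1),$$ normalized so that its first Fourier coefficient is $1$. Write its Fourier expansion as $$f(z)=\sum_{n=1}^{\infty}\lambda_f(n)\,n^{(k-1)/2}e^{2\pi i n z}\qquad(\operatorname{Im} z>0),$$ put $S_f(x)=\sum_{1\le n\le x}\lambda_f(n)$, and let $n_f$ be the smallest positive integer $n$ with $\lambda_f(n)<0$, if there is one. (a) There is an absolute constant $c_0>0$ such that for every positive even integer $k$, every Hecke cusp form $f$ of weight $k$ for $SL(2,\mathbb{Z})$ and every real $x\ge 2$: if $\lambda_f(n)\ge 0$ for all positive integers $n\le x$, then $$\sum_{1\le n\le x}\lambda_f(n)\ \ge\ c_0\,x\log x .$$ (b) Consequently, $S_f(x)=o(x\log x)$ forces $n_f\le x$: if $(k_j)$ is a sequence of positive even integers, $f_j$ is a Hecke cusp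 form of weight $k_j$ for $SL(2,\mathbb{Z})$, $x_j\ge 2$ are real numbers, and $S_{f_j}(x_j)=o(x_j\log x_j)$ as $j\to\infty$, then for all sufficiently large $j$ the number $n_{f_j}$ exists and satisfies $n_{f_j}\le x_j$. -/

import Mathlib

open scoped UpperHalfPlane MatrixGroups ComplexOrder Asymptotics

noncomputable section

namespace HeckeSums

/-- The Hecke operator `T_n` of weight `k` and level one,
`(T_n f)(z) = n ^ (k - 1) ∑_{ad = n} d ^ (-k) ∑_{0 ≤ b < d} f ((a z + b) / d)`.
For `n ≥ 1` the points `(a z + b) / d` lie in the upper half plane, where `ofComplex` is the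
identity. -/
def heckeOperator (k : ℤ) (n : ℕ) (f : ℍ → ℂ) (z : ℍ) : ℂ :=
  (n : ℂ) ^ (k - 1) * ∑ ad ∈ n.divisorsAntidiagonal, (ad.2 : ℂ) ^ (-k) *
    ∑ b ∈ Finset.range ad.2,
      f (UpperHalfPlane.ofComplex (((ad.1 : ℂ) * (z : ℂ) + (b : ℂ)) / (ad.2 : ℂ)))

/-- Hecke cusp forms of weight `k` for `SL(2, ℤ)`: cusp forms which are eigenfunctions of all the
Hecke operators `T_n`, `n ≥ 1`, normalised so that the first Fourier coefficient is `1`. -/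
structure IsHeckeCuspForm {k : ℤ} (f : CuspForm 𝒮ℒ k) : Prop where
  coeff_one : (UpperHalfPlane.qExpansion 1 f).coeff 1 = 1
  eigenform : ∀ n : ℕ, 1 ≤ n → ∃ μ : ℂ, ∀ z : ℍ, heckeOperator k n f z = μ * f z

/-- The normalised Fourier coefficients `λ_f(n)`, `n ≥ 1`, defined by
`f(z) = ∑ λ_f(n) n ^ ((k - 1) / 2) e(n z)`. They are a priori complex numbers. An inequality
`a ≤ b` between complex numbers always means that `b - a` is a nonnegative real number. -/
def lam {k : ℤ} (f : CuspForm 𝒮ℒ k) (n : ℕ) : ℂ :=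
  (UpperHalfPlane.qExpansion 1 f).coeff n / (((n : ℝ) ^ (((k : ℝ) - 1) / 2) : ℝ) : ℂ)

/-- `S_f(x) = ∑_{1 ≤ n ≤ x} λ_f(n)`. -/
def heckeSum {k : ℤ} (f : CuspForm 𝒮ℒ k) (x : ℝ) : ℂ :=
  ∑ n ∈ Finset.Icc 1 ⌊x⌋₊, lam f n

/-- `N` is the first negative eigenvalue index `n_f`: the smallest positive integer `n` with
`λ_f(n) < 0`. -/
def IsFirstNegative {k : ℤ} (f : CuspForm 𝒮ℒ k) (N : ℕ) : Prop :=
  IsLeast {n : ℕ | 1 ≤ n ∧ lam f n < 0} N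

end HeckeSums

end

/-! Let λ be nonnegative on [1, x]. The Hecke relation λ(p)² = λ(p²) + 1 gives λ(p) ≥ 1 for primes p
≤ √x. Moreover λ(p^j) = sin((j+1)θ)/sin θ unless λ(p) ≥ 2, and nonnegativity of every λ(p^j) with
p^j ≤ x forces θ to be small, so λ(p^j) is nearly at least j + 1 when p^j is a small power of x. By
multiplicativity λ(m) is at least a constant times the divisor function d(m) for m ≤ x^(1/10)
(`ge_card_divisors`).

Since λ at primes is controlled only up to √x, the sum is restricted to n = mpq with m small and two
large primes q < p ≤ √x, where λ(n) ≥ d(m)/2. Summing over q by Chebyshev gives x/(mp log x) up to a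
constant; ∑ 1/p between fixed powers of x is bounded below, and ∑ d(m)/m ≫ (log x)². The total is x
log x (`exists_le_sum_of_pow_le`); bounded x are covered by λ(1) = 1.

The Hecke relations for λ_f come from comparing Fourier coefficients in T_n f = μ f (`hecke_coeff`).
Reality of λ_f is self-adjointness of T_n: with a weight χ whose SL(2, ℤ)-translates sum to 1, the
Petersson product of f and T_n f unfolds to a sum over all integral matrices A of determinant n, and
A ↦ adj A conjugates its terms (`conj_eq_of_heckeOperator_eq`). Reality also turns "no negative
value up to x" into nonnegativity, so (b) follows from the bound behind (a). -/

noncomputable section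

/-! ### Lower bounds for nonnegative Hecke multiplicative functions. -/

namespace HeckeSums

/-- The identities satisfied by normalised Hecke eigenvalues: multiplicativity and the
three-term recursion along powers of a prime. -/
structure IsHeckeMultiplicative (l : ℕ → ℝ) : Prop where
  map_one : l 1 = 1
  map_mul : ∀ m n : ℕ, 1 ≤ m → 1 ≤ n → m.Coprime n → l (m * n) = l m * l n
  map_prime_pow : ∀ p j : ℕ, p.Prime → l p * l (p ^ (j + 1)) = l (p ^ (j + 2)) + l (p ^ j)

section Recursion

variable {a : ℕ → ℝ}

/-- For `a 1 ≥ 2` the recursion makes the differences `a (j + 1) - a j` nondecreasing, starting from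
at least 1. -/
lemma succ_le_of_two_le (h0 : a 0 = 1) (hrec : ∀ j, a (j + 2) = a 1 * a (j + 1) - a j)
    (h2 : 2 ≤ a 1) (j : ℕ) : (j : ℝ) + 1 ≤ a j := by
  suffices h : (j : ℝ) + 1 ≤ a j ∧ 1 ≤ a (j + 1) - a j from h.1
  induction j with
  | zero => constructor <;> norm_num [h0]; linarith
  | succ j ih =>
    obtain ⟨h1, h3⟩ := ih
    have hj : (0 : ℝ) ≤ j := j.cast_nonneg
    refine ⟨by push_cast; linarith, ?_⟩
    rw [show j + 1 + 1 = j + 2 from rfl, hrec]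
    nlinarith

/-- These are the Chebyshev polynomials of the second kind at cos θ. -/
lemma mul_sin_arccos_eq (h0 : a 0 = 1) (hrec : ∀ j, a (j + 2) = a 1 * a (j + 1) - a j)
    {θ : ℝ} (hθ : a 1 = 2 * Real.cos θ) (j : ℕ) :
    a j * Real.sin θ = Real.sin ((j + 1) * θ) := by
  suffices h : a j * Real.sin θ = Real.sin ((j + 1) * θ) ∧
      a (j + 1) * Real.sin θ = Real.sin ((j + 2) * θ) from h.1
  induction j with
  | zero =>
    refine ⟨by simp [h0], ?_⟩
    simp only [zero_add, CharP.cast_eq_zero, hθ, Real.sin_two_mul]; ring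
  | succ j ih =>
    obtain ⟨h1, h2⟩ := ih
    refine ⟨by rw [h2]; push_cast; ring_nf, ?_⟩
    rw [show j + 1 + 1 = j + 2 from rfl, hrec, sub_mul, mul_assoc, h2, h1, hθ]
    push_cast
    have e1 : ((j : ℝ) + 1 + 2) * θ = (j + 2) * θ + θ := by ring
    have e2 : ((j : ℝ) + 1) * θ = (j + 2) * θ - θ := by ring
    rw [e1, e2, Real.sin_add, Real.sin_sub]; ring

/-- Nonnegativity of `a 0, …, a J` forces `a j` to be close to `j + 1` for `j` small
compared with `J`. -/
lemma le_of_recursion_nonneg (h0 : a 0 = 1) (hrec : ∀ j, a (j + 2) = a 1 * a (j + 1) - a j)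
    {J : ℕ} (hJ : 1 ≤ J) (hpos : ∀ j ≤ J, 0 ≤ a j) {j : ℕ} (hjJ : j ≤ J) :
    (j + 1) * (1 - ((j + 1) * (Real.pi / (J + 1))) ^ 2 / 6) ≤ a j := by
  have hj : (0 : ℝ) ≤ j := j.cast_nonneg
  rcases le_or_gt 2 (a 1) with h2 | h2
  · refine le_trans ?_ (succ_le_of_two_le h0 hrec h2 j)
    have : 0 ≤ ((j + 1) * (Real.pi / ((J : ℝ) + 1))) ^ 2 := sq_nonneg _
    nlinarith
  have h1 := hpos 1 hJ
  set θ := Real.arccos (a 1 / 2) with hθdef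
  have hcos : a 1 = 2 * Real.cos θ := by
    rw [hθdef, Real.cos_arccos (by linarith) (by linarith)]; ring
  have hθ0 : 0 < θ := Real.arccos_pos.2 (by linarith)
  have hθ2 : θ ≤ Real.pi / 2 := Real.arccos_le_pi_div_two.2 (by linarith)
  have hsin : 0 < Real.sin θ := Real.sin_pos_of_pos_of_lt_pi hθ0 (by linarith [Real.pi_pos])
  have key := mul_sin_arccos_eq h0 hrec hcos
  -- The multiples of θ advance by at most π/2, so the first one beyond π would lie in (π, 2π),
  -- where the sine is negative.
  have hJθ : ∀ i ≤ J, ((i : ℝ) + 1) * θ ≤ Real.pi := by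
    intro i
    induction i with
    | zero => intro _; simp; linarith [Real.pi_pos]
    | succ i ih =>
      intro hi
      by_contra! hcon
      have h3 := ih (by omega)
      have h4 := mul_nonneg (hpos (i + 1) hi) hsin.le
      rw [key] at h4
      have h5 : Real.sin ((((i + 1 : ℕ) : ℝ) + 1) * θ - 2 * Real.pi) < 0 := by
        apply Real.sin_neg_of_neg_of_neg_pi_lt
        · push_cast at *; linarith [Real.pi_pos]
        · linarith
      rw [Real.sin_sub_two_pi] at h5
      linarith
  have hθJ : θ ≤ Real.pi / (J + 1) := by
    rw [le_div_iff₀ (by positivity)]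
    linarith [hJθ J le_rfl]
  -- Numerator from below by sin y ≥ y - y³/6, denominator from above by sin θ ≤ θ.
  have h6 : (j + 1) * θ - ((j + 1) * θ) ^ 3 / 6 ≤ a j * Real.sin θ := by
    rw [key]
    exact Real.sin_ge_sub_cube (by positivity)
  have h7 : ((j + 1) * θ) ^ 2 ≤ ((j + 1) * (Real.pi / ((J : ℝ) + 1))) ^ 2 := by gcongr
  refine le_trans (b := (j + 1) * (1 - ((j + 1) * θ) ^ 2 / 6)) (by gcongr) ?_
  rcases le_or_gt ((j + 1) * (1 - ((j + 1) * θ) ^ 2 / 6)) 0 with h8 | h8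
  · exact h8.trans (hpos j hjJ)
  by_contra! hcon
  have h9 := mul_lt_mul_of_pos_right hcon hsin
  have h10 := mul_le_mul_of_nonneg_left (Real.sin_le hθ0.le) h8.le
  nlinarith

end Recursion

variable {l : ℕ → ℝ} {x : ℝ}

lemma IsHeckeMultiplicative.one_le_of_sq_le (hl : IsHeckeMultiplicative l)
    (hpos : ∀ n : ℕ, 1 ≤ n → (n : ℝ) ≤ x → 0 ≤ l n) {p : ℕ} (hp : p.Prime)
    (hpx : (p : ℝ) ^ 2 ≤ x) : 1 ≤ l p := by
  have hp1 : (1 : ℝ) ≤ p := by exact_mod_cast hp.one_le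
  have h1 := hpos p hp.one_le (by nlinarith)
  have h2 := hpos (p ^ 2) (Nat.one_le_pow _ _ hp.pos) (by push_cast; exact hpx)
  have h3 := hl.map_prime_pow p 0 hp
  simp only [zero_add, pow_one, pow_zero, hl.map_one] at h3
  nlinarith

/-- Take J maximal with p^J ≤ x, so that log x < (J + 1) log p; with j + 1 ≤ 2j the angle (j +
1)π/(J + 1) is at most 2π log(p^j)/log x. -/
lemma IsHeckeMultiplicative.prime_pow_ge (hl : IsHeckeMultiplicative l) (hx : 2 ≤ x)
    (hpos : ∀ n : ℕ, 1 ≤ n → (n : ℝ) ≤ x → 0 ≤ l n) {p j : ℕ} (hp : p.Prime) (hj : 0 < j)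
    (hpx : ((p ^ j : ℕ) : ℝ) ≤ x) :
    (j + 1) * (1 - 7 * (Real.log (p ^ j : ℕ) / Real.log x) ^ 2) ≤ l (p ^ j) := by
  have hp1 : (1 : ℝ) < p := by exact_mod_cast hp.one_lt
  have hlp : 0 < Real.log p := Real.log_pos hp1
  have hlx : 0 < Real.log x := Real.log_pos (by linarith)
  have hxf : ⌊x⌋₊ ≠ 0 := (Nat.floor_pos.2 (by linarith)).ne'
  set J := Nat.log p ⌊x⌋₊ with hJ
  have hjJ : j ≤ J := Nat.le_log_of_pow_le hp.one_lt (Nat.le_floor hpx)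
  have hJx : ∀ i ≤ J, ((p ^ i : ℕ) : ℝ) ≤ x := fun i hi =>
    (Nat.le_floor_iff (by linarith)).1 ((Nat.pow_le_pow_right hp.pos hi).trans
      (Nat.pow_log_le_self p hxf))
  have hmain := le_of_recursion_nonneg (a := fun i => l (p ^ i)) (by simp [hl.map_one])
    (fun i => by simpa [pow_one] using eq_sub_of_add_eq (hl.map_prime_pow p i hp).symm)
    (J := J) (by omega)
    (fun i hi => hpos _ (Nat.one_le_pow _ _ hp.pos) (hJx i hi)) hjJ
  refine le_trans ?_ hmain
  have hlogx : Real.log x ≤ (J + 1) * Real.log p := by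
    have h1 : x < ((p ^ (J + 1) : ℕ) : ℝ) :=
      (Nat.floor_lt (by linarith)).1 (Nat.lt_pow_succ_log_self hp.one_lt _)
    have h2 := Real.log_le_log (by linarith) h1.le
    push_cast at h2
    rw [Real.log_pow] at h2
    exact_mod_cast h2
  have hj1 : (1 : ℝ) ≤ j := by exact_mod_cast hj
  have h1 : ((j : ℝ) + 1) * (Real.pi / (J + 1)) ≤
      2 * Real.pi * (Real.log (p ^ j : ℕ) / Real.log x) := by
    push_cast
    rw [Real.log_pow, ← mul_div_assoc, ← mul_div_assoc, div_le_div_iff₀ (by positivity) hlx]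
    calc ((j : ℝ) + 1) * Real.pi * Real.log x
        ≤ (2 * j) * Real.pi * ((J + 1) * Real.log p) := by gcongr; linarith
      _ = _ := by ring
  have h2 : (((j : ℝ) + 1) * (Real.pi / (J + 1))) ^ 2 ≤
      (2 * Real.pi * (Real.log (p ^ j : ℕ) / Real.log x)) ^ 2 :=
    pow_le_pow_left₀ (by positivity) h1 2
  -- The constant 7 dominates (2π)²/6 ≤ 40/6.
  have h3 : Real.pi ^ 2 ≤ 10 := by nlinarith [Real.pi_lt_d2, Real.pi_pos]
  have h4 := mul_le_mul_of_nonneg_right h3 (sq_nonneg (Real.log (p ^ j : ℕ) / Real.log x))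
  gcongr
  nlinarith

/-- The relative loss is quadratic in log m, and u² + v² ≤ (u + v)², so the bound survives coprime
products. The restriction on m keeps the factors nonnegative, as multiplying inequalities requires.
-/
lemma IsHeckeMultiplicative.ge_card_divisors (hl : IsHeckeMultiplicative l) (hx : 2 ≤ x)
    (hpos : ∀ n : ℕ, 1 ≤ n → (n : ℝ) ≤ x → 0 ≤ l n) (m : ℕ) (hm : 1 ≤ m)
    (hmx : 10 * Real.log m ≤ Real.log x) :
    (m.divisors.card : ℝ) * (1 - 7 * (Real.log m / Real.log x) ^ 2) ≤ l m := by
  have hlx : 0 < Real.log x := Real.log_pos (by linarith)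
  have hle : ∀ m : ℕ, 1 ≤ m → 10 * Real.log m ≤ Real.log x →
      0 ≤ 1 - 7 * (Real.log m / Real.log x) ^ 2 := by
    intro m hm h
    have h0 : 0 ≤ Real.log m / Real.log x := div_nonneg (Real.log_natCast_nonneg m) hlx.le
    have h1 : Real.log m / Real.log x ≤ 1 / 10 := by
      rw [div_le_div_iff₀ hlx (by norm_num)]; linarith
    nlinarith
  induction m using Nat.recOnPosPrimePosCoprime with
  | zero => omega
  | one => simp [hl.map_one]
  | prime_pow p j hp hj =>
    have h1 : ((p ^ j : ℕ) : ℝ) ≤ x := by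
      rw [← Real.log_le_log_iff (by exact_mod_cast hm) (by linarith)]
      have := Real.log_natCast_nonneg (p ^ j)
      linarith
    simpa [Nat.divisors_prime_pow hp] using hl.prime_pow_ge hx hpos hp hj h1
  | coprime a b ha hb hab iha ihb =>
    have ha0 := Real.log_natCast_nonneg a
    have hb0 := Real.log_natCast_nonneg b
    have hlog : Real.log (a * b : ℕ) = Real.log a + Real.log b := by
      push_cast
      exact Real.log_mul (by positivity) (by positivity)
    rw [hlog] at hmx
    have iha := iha ha.le (by linarith)
    have ihb := ihb hb.le (by linarith)
    have hA := hle a ha.le (by linarith)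
    have hB := hle b hb.le (by linarith)
    rw [hl.map_mul a b ha.le hb.le hab, hab.card_divisors_mul, hlog, Nat.cast_mul]
    refine le_trans ?_ (mul_le_mul iha ihb (by positivity) (le_trans (by positivity) iha))
    rw [mul_mul_mul_comm]
    gcongr
    rw [add_div]
    have hu : 0 ≤ Real.log a / Real.log x := by positivity
    have hv : 0 ≤ Real.log b / Real.log x := by positivity
    nlinarith [mul_nonneg hu hv, sq_nonneg (Real.log a / Real.log x * (Real.log b / Real.log x))]

end HeckeSums

/-! ### Elementary estimates for divisors and primes. -/

namespace HeckeSums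

open Finset Filter Topology

lemma log_le_sum_Ioc_inv {M N : ℕ} (h : M ≤ N) :
    Real.log (N + 1) - Real.log (M + 1) ≤ ∑ a ∈ Ioc M N, (1 : ℝ) / a := by
  induction N, h using Nat.le_induction with
  | base => simp
  | succ N h ih =>
    rw [Finset.sum_Ioc_succ_top h]
    have h1 : Real.log ((N : ℝ) + 1 + 1) - Real.log (N + 1) ≤ 1 / ((N : ℝ) + 1) := by
      rw [← Real.log_div (by positivity) (by positivity)]
      refine (Real.log_le_sub_one_of_pos (by positivity)).trans (le_of_eq ?_)
      field_simp
      ring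
    push_cast
    linarith

/-- Expand the square and group the pairs (a, b) by m = ab: each m arises at most d(m) times. -/
lemma sum_inv_sq_le_sum_card_divisors (M N : ℕ) :
    (∑ a ∈ Ioc M N, (1 : ℝ) / a) ^ 2 ≤
      ∑ m ∈ Ioc (M ^ 2) (N ^ 2), (m.divisors.card : ℝ) / m := by
  have hmaps : ∀ ab ∈ Ioc M N ×ˢ Ioc M N, ab.1 * ab.2 ∈ Ioc (M ^ 2) (N ^ 2) := by
    intro ab hab
    simp only [mem_product, mem_Ioc] at hab ⊢
    rw [sq, sq]
    exact ⟨Nat.mul_lt_mul'' hab.1.1 hab.2.1, Nat.mul_le_mul hab.1.2 hab.2.2⟩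
  rw [sq, sum_mul_sum, ← sum_product', ← sum_fiberwise_of_maps_to hmaps]
  refine sum_le_sum fun m hm => ?_
  have hm0 : m ≠ 0 := by
    have := (mem_Ioc.1 hm).1
    omega
  calc ∑ ab ∈ Ioc M N ×ˢ Ioc M N with ab.1 * ab.2 = m, (1 : ℝ) / ab.1 * (1 / ab.2)
      = ∑ ab ∈ Ioc M N ×ˢ Ioc M N with ab.1 * ab.2 = m, (1 : ℝ) / m := by
        refine sum_congr rfl fun ab hab => ?_
        rw [← (mem_filter.1 hab).2]
        push_cast
        rw [div_mul_div_comm, one_mul]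
    _ ≤ (m.divisors.card : ℝ) * (1 / m) := by
        rw [sum_const, nsmul_eq_mul]
        gcongr
        refine card_le_card_of_injOn Prod.fst (fun ab hab => ?_) fun ab hab cd hcd h => ?_
        · have h1 := (mem_filter.1 (mem_coe.1 hab)).2
          exact mem_coe.2 (Nat.mem_divisors.2 ⟨⟨ab.2, h1.symm⟩, hm0⟩)
        · have h1 := (mem_filter.1 (mem_coe.1 hab)).2
          have h2 := (mem_filter.1 (mem_coe.1 hcd)).2
          have h3 : ab.1 ≠ 0 := by rintro h3; rw [h3, zero_mul] at h1; exact hm0 h1.symm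
          refine Prod.ext h (Nat.eq_of_mul_eq_mul_left (Nat.pos_of_ne_zero h3) ?_)
          rw [h1, h, h2]
    _ = _ := by ring

/-- Chebyshev's lower bound for primes in `(u, 4u]`. -/
lemma eventually_le_sum_log_primes :
    ∀ᶠ u : ℕ in atTop, (u : ℝ) ≤ ∑ p ∈ (Ioc u (4 * u)).filter Nat.Prime, Real.log p := by
  -- At v = 4u this error is at most 0.32u, less than the excess of 4u log 2 - u log 4 = 2u log 2
  -- over u.
  have h1 : ∀ᶠ v : ℝ in atTop,
      Real.log (v + 1) + 2 * √v * Real.log v ≤ (8 / 100) * v := by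
    filter_upwards [(isLittleO_log_rpow_atTop (r := 1 / 2) (by norm_num)).bound
      (c := 2 / 100) (by norm_num), eventually_ge_atTop 2] with v hv hv2
    have hlog : 0 ≤ Real.log v := Real.log_nonneg (by linarith)
    rw [← Real.sqrt_eq_rpow, Real.norm_of_nonneg hlog, Real.norm_of_nonneg (by positivity)] at hv
    have hs1 : 1 ≤ √v := Real.one_le_sqrt.2 (by linarith)
    have hs : √v * √v = v := Real.mul_self_sqrt (by linarith)
    have h2 : Real.log (v + 1) ≤ 2 * Real.log v := by
      have := Real.log_le_log (by linarith) (by nlinarith : v + 1 ≤ v ^ 2)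
      rw [Real.log_pow] at this
      exact_mod_cast this
    nlinarith
  have h2 : ∀ᶠ u : ℕ in atTop, Real.log (4 * u + 1) + 2 * √(4 * u) * Real.log (4 * u) ≤
      (8 / 100) * (4 * (u : ℝ)) :=
    (tendsto_natCast_atTop_atTop.const_mul_atTop (by norm_num : (0 : ℝ) < 4)).eventually h1
  filter_upwards [h2] with u hu
  have h3 := Chebyshev.theta_ge (4 * u)
  have h4 := Chebyshev.theta_le_log4_mul_x (x := u) (by positivity)
  have h5 : Chebyshev.theta (4 * u : ℕ) - Chebyshev.theta u =
      ∑ p ∈ (Ioc u (4 * u)).filter Nat.Prime, Real.log p := by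
    rw [Chebyshev.theta, Chebyshev.theta, Nat.floor_natCast, Nat.floor_natCast,
      ← Finset.Ioc_union_Ioc_eq_Ioc (Nat.zero_le u) (by omega : u ≤ 4 * u), filter_union,
      sum_union (disjoint_filter_filter (Finset.Ioc_disjoint_Ioc_of_le le_rfl)), add_sub_cancel_left]
  rw [← h5]
  have h6 : Real.log 4 = 2 * Real.log 2 := by
    rw [show (4 : ℝ) = 2 ^ 2 by norm_num, Real.log_pow]; norm_num
  have h7 := Real.log_two_gt_d9
  push_cast at h3 ⊢
  rw [h6] at h4
  have hu0 : (0 : ℝ) ≤ u := u.cast_nonneg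
  nlinarith

/-- Cut the range into i blocks (u, 4u]. Each contributes at least 1/(4 log 4u), and every logarithm
is replaced by the one at the final endpoint. -/
lemma exists_le_sum_Ioc_prime_inv : ∃ N₀ : ℕ, ∀ N ≥ N₀, ∀ i : ℕ,
    i / (4 * Real.log (4 ^ i * N : ℕ)) ≤
      ∑ p ∈ (Ioc N (4 ^ i * N)).filter Nat.Prime, (1 : ℝ) / p := by
  obtain ⟨N₀, hN₀⟩ := eventually_atTop.1 eventually_le_sum_log_primes
  refine ⟨max N₀ 2, fun N hN i => ?_⟩
  have hN1 : N₀ ≤ N := le_trans (le_max_left _ _) hN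
  have hN2 : 2 ≤ N := le_trans (le_max_right _ _) hN
  induction i with
  | zero => simp
  | succ i ih =>
    set u := 4 ^ i * N with hu
    have hNu : N ≤ u := Nat.le_mul_of_pos_left _ (by positivity)
    have hu4 : 4 ^ (i + 1) * N = 4 * u := by rw [hu, pow_succ]; ring
    rw [hu4, ← Finset.Ioc_union_Ioc_eq_Ioc hNu (by omega : u ≤ 4 * u), filter_union,
      sum_union (disjoint_filter_filter (Finset.Ioc_disjoint_Ioc_of_le le_rfl))]
    have hu2 : (2 : ℝ) ≤ u := by exact_mod_cast hN2.trans hNu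
    have hlogu : 0 < Real.log u := Real.log_pos (by linarith)
    have hlog4u : Real.log u ≤ Real.log (4 * u : ℕ) :=
      Real.log_le_log (by linarith) (by push_cast; linarith)
    have hblock : 1 / (4 * Real.log (4 * u : ℕ)) ≤
        ∑ p ∈ (Ioc u (4 * u)).filter Nat.Prime, (1 : ℝ) / p := by
      have h1 := hN₀ u (hN1.trans hNu)
      calc 1 / (4 * Real.log (4 * u : ℕ)) = u / (4 * u * Real.log (4 * u : ℕ)) := by
            field_simp
        _ ≤ (∑ p ∈ (Ioc u (4 * u)).filter Nat.Prime, Real.log p) /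
              (4 * u * Real.log (4 * u : ℕ)) := by gcongr
        _ ≤ _ := by
            rw [sum_div]
            refine sum_le_sum fun p hp => ?_
            simp only [mem_filter, mem_Ioc] at hp
            have hp0 : (0 : ℝ) < p := by exact_mod_cast hp.2.pos
            have hp4 : (p : ℝ) ≤ 4 * u := by exact_mod_cast hp.1.2
            have hlp : Real.log p ≤ Real.log (4 * u : ℕ) :=
              Real.log_le_log hp0 (by push_cast; exact hp4)
            rw [div_le_div_iff₀ (mul_pos (by linarith) (hlogu.trans_le hlog4u)) hp0]
            have := Real.log_natCast_nonneg p
            nlinarith [mul_le_mul hlp hp4 hp0.le (this.trans hlp)]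
    have hi : (i : ℝ) / (4 * Real.log (4 * u : ℕ)) ≤ i / (4 * Real.log u) := by gcongr
    push_cast at *
    rw [add_div]
    linarith

/-- About log T / log 4 blocks of ratio 4 fit between T^49 and T^50. Since log T ≤ 4i and the
endpoint has logarithm at most 50 log T, the sum is at least 1/(4·4·50). -/
lemma eventually_le_sum_Ioc_prime_inv : ∀ᶠ T : ℕ in atTop,
    (1 / 800 : ℝ) ≤ ∑ p ∈ (Ioc (T ^ 49) (T ^ 50)).filter Nat.Prime, (1 : ℝ) / p := by
  obtain ⟨N₀, hN₀⟩ := exists_le_sum_Ioc_prime_inv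
  filter_upwards [eventually_ge_atTop (max N₀ 4)] with T hT
  have hT0 : N₀ ≤ T := le_trans (le_max_left _ _) hT
  have hT4 : 4 ≤ T := le_trans (le_max_right _ _) hT
  set i := Nat.log 4 T
  have hi1 : 1 ≤ i := Nat.le_log_of_pow_le (by norm_num) (by simpa using hT4)
  have hiT : 4 ^ i ≤ T := Nat.pow_log_le_self 4 (by omega)
  have hTi : T < 4 ^ (i + 1) := Nat.lt_pow_succ_log_self (by norm_num) T
  have hle : 4 ^ i * T ^ 49 ≤ T ^ 50 := by
    rw [pow_succ' T 49]
    gcongr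
  have hTr : (4 : ℝ) ≤ T := by exact_mod_cast hT4
  have hlogT : 0 < Real.log T := Real.log_pos (by linarith)
  have h1 := hN₀ (T ^ 49) (hT0.trans (Nat.le_self_pow (by norm_num) T)) i
  have h2 : Real.log (4 ^ i * T ^ 49 : ℕ) ≤ 50 * Real.log T := by
    have : Real.log (4 ^ i * T ^ 49 : ℕ) ≤ Real.log ((T ^ 50 : ℕ) : ℝ) :=
      Real.log_le_log (by positivity) (by exact_mod_cast hle)
    refine this.trans (le_of_eq ?_)
    push_cast
    rw [Real.log_pow]; norm_num
  have h2' : 0 < Real.log (4 ^ i * T ^ 49 : ℕ) := by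
    apply Real.log_pos
    have : 1 < 4 ^ i * T ^ 49 :=
      lt_of_lt_of_le (by omega : 1 < T) ((Nat.le_self_pow (by norm_num) T).trans
        (Nat.le_mul_of_pos_left _ (by positivity)))
    exact_mod_cast this
  have h3 : Real.log T ≤ 4 * i := by
    have h4 : Real.log T ≤ Real.log ((4 ^ (i + 1) : ℕ) : ℝ) :=
      Real.log_le_log (by linarith) (by exact_mod_cast hTi.le)
    push_cast at h4
    rw [Real.log_pow] at h4
    have h5 : Real.log 4 ≤ 2 := by
      rw [show (4 : ℝ) = 2 ^ 2 by norm_num, Real.log_pow]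
      have := Real.log_two_lt_d9
      push_cast
      linarith
    have h6 : (1 : ℝ) ≤ i := by exact_mod_cast hi1
    push_cast at h4
    nlinarith
  calc (1 / 800 : ℝ) ≤ i / (4 * (50 * Real.log T)) := by
        rw [div_le_div_iff₀ (by norm_num) (by positivity)]
        linarith
    _ ≤ i / (4 * Real.log (4 ^ i * T ^ 49 : ℕ)) := by gcongr
    _ ≤ _ := h1
    _ ≤ _ := by
        refine sum_le_sum_of_subset_of_nonneg ?_ fun _ _ _ => by positivity
        exact filter_subset_filter _ (Finset.Ioc_subset_Ioc_right hle)

/-- Chebyshev's bound for π(y); the excluded primes up to T^30 are negligible against y ≥ T^42. -/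
lemma eventually_le_card_primes : ∀ᶠ T : ℕ in atTop, ∀ y : ℝ, (T : ℝ) ^ 42 ≤ y →
    y ≤ (T : ℝ) ^ 101 →
    y / (1000 * Real.log T) ≤ ((Ioc (T ^ 30) ⌊y⌋₊).filter Nat.Prime).card := by
  have h1 : ∀ᶠ y : ℝ in atTop, Real.log 2 + Real.log (y + 2) ≤ 1 / 10 * y := by
    filter_upwards [Real.isLittleO_log_id_atTop.bound (c := 1 / 20) (by norm_num),
      eventually_ge_atTop 28] with y hy hy2
    rw [id, Real.norm_of_nonneg (Real.log_nonneg (by linarith)),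
      Real.norm_of_nonneg (by linarith)] at hy
    have h := Real.log_le_log (by linarith) (by linarith : y + 2 ≤ 2 * y)
    rw [Real.log_mul (by norm_num) (by linarith)] at h
    have := Real.log_two_lt_d9
    linarith
  obtain ⟨Y, hY⟩ := eventually_atTop.1 h1
  filter_upwards [eventually_ge_atTop (max ⌈Y⌉₊ 4)] with T hT y hy1 hy2
  have hTY : Y ≤ T := (Nat.le_ceil Y).trans (by exact_mod_cast le_trans (le_max_left _ _) hT)
  have hT4 : (4 : ℝ) ≤ T := by exact_mod_cast le_trans (le_max_right _ _) hT
  have hTy : (T : ℝ) ≤ y := le_trans (le_self_pow₀ (by linarith) (by norm_num)) hy1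
  have hlogT : 0 < Real.log T := Real.log_pos (by linarith)
  have hlogy : 0 < Real.log y := Real.log_pos (by linarith)
  have hlogyT : Real.log y ≤ 101 * Real.log T := by
    have := Real.log_le_log (by linarith) hy2
    rw [Real.log_pow] at this
    exact_mod_cast this
  have h2 := Chebyshev.pi_ge' (x := y) (by linarith)
  have h3 : y / (202 * Real.log T) ≤ Nat.primeCounting ⌊y⌋₊ := by
    refine le_trans ?_ h2
    rw [div_le_div_iff₀ (by positivity) hlogy]
    have h4 := hY y (hTY.trans hTy)
    have h5 : y / 2 ≤ (y - 1) * Real.log 2 - Real.log (y + 2) := by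
      nlinarith [Real.log_two_gt_d9]
    nlinarith
  have h4 : (Nat.primeCounting ⌊y⌋₊ : ℝ) ≤
      T ^ 30 + ((Ioc (T ^ 30) ⌊y⌋₊).filter Nat.Prime).card := by
    rw [← Nat.primesLE_card_eq_primeCounting, Nat.primesLE_eq_filter_Ioc_zero]
    have hsub : (Ioc 0 ⌊y⌋₊).filter Nat.Prime ⊆
        Ioc 0 (T ^ 30) ∪ (Ioc (T ^ 30) ⌊y⌋₊).filter Nat.Prime := by
      intro p hp
      simp only [mem_filter, mem_union, mem_Ioc] at hp ⊢
      by_cases h : p ≤ T ^ 30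
      · exact Or.inl ⟨hp.1.1, h⟩
      · exact Or.inr ⟨⟨not_le.1 h, hp.1.2⟩, hp.2⟩
    have := (card_le_card hsub).trans (card_union_le _ _)
    rw [Nat.card_Ioc, Nat.sub_zero] at this
    exact_mod_cast this
  have h5 : (T : ℝ) ^ 30 + y / (1000 * Real.log T) ≤ y / (202 * Real.log T) := by
    have h6 : (T : ℝ) ^ 30 ≤ y / (400 * Real.log T) := by
      rw [le_div_iff₀ (by positivity)]
      refine le_trans ?_ hy1
      have h7 : Real.log T ≤ T := (Real.log_le_sub_one_of_pos (by linarith)).trans (by linarith)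
      have h8 : (400 : ℝ) ≤ T ^ 11 := le_trans (by norm_num) (pow_le_pow_left₀ (by norm_num) hT4 11)
      calc (T : ℝ) ^ 30 * (400 * Real.log T) ≤ (T : ℝ) ^ 30 * ((T : ℝ) ^ 11 * T) := by gcongr
        _ = (T : ℝ) ^ 42 := by ring
    have h7 : 0 ≤ y / Real.log T := div_nonneg (by linarith) hlogT.le
    have e : ∀ c : ℝ, y / (c * Real.log T) = c⁻¹ * (y / Real.log T) := by
      intro c; rw [mul_comm, ← div_div, div_eq_inv_mul]
    rw [e] at h6 ⊢
    rw [e]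
    linarith
  linarith

end HeckeSums

/-! ### Summation over n = mpq. -/

namespace HeckeSums

open Finset Filter Topology

variable {l : ℕ → ℝ} {x : ℝ}

/-- A factorisation `m p q` with `m` small and `q < p` large primes determines its factors. -/
lemma injOn_mul_prime_mul_prime {A B C : ℕ} (hAB : A ≤ B) :
    Set.InjOn (fun t : (ℕ × ℕ) × ℕ => t.1.1 * t.1.2 * t.2)
      {t | t.1.1 ∈ Ioc 0 A ∧ (t.1.2.Prime ∧ C < t.1.2) ∧ t.2.Prime ∧ B < t.2 ∧ t.2 < C} := by
  rintro ⟨⟨m, p⟩, q⟩ ⟨hm, ⟨hp, hCp⟩, hq, hBq, hqC⟩ ⟨⟨m', p'⟩, q'⟩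
    ⟨hm', ⟨hp', hCp'⟩, hq', hBq', hqC'⟩ h
  simp only [mem_Ioc] at hm hm' hp hCp hq hBq hqC hp' hCp' hq' hBq' hqC' h
  have hpp : p = p' := by
    have hdvd : p ∣ m' * p' * q' := by rw [← h]; exact ⟨m * q, by ring⟩
    rcases hp.dvd_mul.1 hdvd with h1 | h1
    · rcases hp.dvd_mul.1 h1 with h2 | h2
      · have := Nat.le_of_dvd hm'.1 h2
        omega
      · exact (Nat.prime_dvd_prime_iff_eq hp hp').1 h2
    · have := (Nat.prime_dvd_prime_iff_eq hp hq').1 h1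
      omega
  subst hpp
  have h1 : m * q = m' * q' := by
    apply Nat.eq_of_mul_eq_mul_left hp.pos
    linarith
  have hqq : q = q' := by
    have hdvd : q ∣ m' * q' := by rw [← h1]; exact ⟨m, by ring⟩
    rcases hq.dvd_mul.1 hdvd with h2 | h2
    · have := Nat.le_of_dvd hm'.1 h2
      omega
    · exact (Nat.prime_dvd_prime_iff_eq hq hq').1 h2
  subst hqq
  rw [Nat.eq_of_mul_eq_mul_right hq.pos h1]

lemma IsHeckeMultiplicative.le_mul_prime_mul_prime (hl : IsHeckeMultiplicative l) (hx : 2 ≤ x)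
    (hpos : ∀ n : ℕ, 1 ≤ n → (n : ℝ) ≤ x → 0 ≤ l n) {m p q : ℕ} (hm : 1 ≤ m)
    (hmx : 10 * Real.log m ≤ Real.log x) (hp : p.Prime) (hpx : (p : ℝ) ^ 2 ≤ x) (hq : q.Prime)
    (hqp : q < p) (hmq : m < q) : (m.divisors.card : ℝ) / 2 ≤ l (m * p * q) := by
  have hlx : 0 < Real.log x := Real.log_pos (by linarith)
  have h1 := hl.ge_card_divisors hx hpos m hm hmx
  have h2 := hl.one_le_of_sq_le hpos hp hpx
  have h3 := hl.one_le_of_sq_le hpos hq (le_trans (by gcongr) hpx)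
  have hmp : m.Coprime p := (Nat.coprime_of_lt_prime (by omega) (hmq.trans hqp) hp).symm
  have hmq' : m.Coprime q := (Nat.coprime_of_lt_prime (by omega) hmq hq).symm
  have hpq : p.Coprime q := (Nat.coprime_primes hp hq).2 hqp.ne'
  rw [hl.map_mul _ _ (Nat.mul_pos hm hp.pos) hq.one_le (hmq'.mul_left hpq),
    hl.map_mul _ _ hm hp.one_le hmp]
  have h4 : (m.divisors.card : ℝ) / 2 ≤ l m := by
    refine le_trans ?_ h1
    have h0 : 0 ≤ Real.log m / Real.log x := div_nonneg (Real.log_natCast_nonneg m) hlx.le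
    have h1 : Real.log m / Real.log x ≤ 1 / 10 := by
      rw [div_le_div_iff₀ hlx (by norm_num)]; linarith
    rw [div_eq_mul_inv]
    gcongr
    nlinarith
  have h5 : 0 ≤ l m := le_trans (by positivity) h4
  exact h4.trans ((le_mul_of_one_le_right h5 h2).trans
    (le_mul_of_one_le_right (mul_nonneg h5 (by linarith)) h3))

set_option maxHeartbeats 400000 in
-- The ranges T^4 < m ≤ T^8 and T^49 < p ≤ T^50 put x/(mp) in [T^42, T^48), so the primes q in
-- (T^30, x/(mp)] satisfy m < q < p. Also p² ≤ T^100 ≤ x, and log m ≤ 8 log T is below log x / 10.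
lemma exists_le_sum_of_pow_le : ∃ T₀ : ℕ, ∀ T ≥ T₀, ∀ x : ℝ, (T : ℝ) ^ 100 ≤ x →
    x ≤ (T : ℝ) ^ 101 → ∀ l : ℕ → ℝ, IsHeckeMultiplicative l →
    (∀ n : ℕ, 1 ≤ n → (n : ℝ) ≤ x → 0 ≤ l n) →
    1 / 161600000 * (x * Real.log x) ≤ ∑ n ∈ Icc 1 ⌊x⌋₊, l n := by
  obtain ⟨T₀, hT₀⟩ := eventually_atTop.1
    (eventually_le_sum_Ioc_prime_inv.and eventually_le_card_primes)
  refine ⟨max T₀ 4, fun T hT x hTx hxT l hl hpos => ?_⟩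
  have hT4 : 4 ≤ T := le_trans (le_max_right _ _) hT
  obtain ⟨hP, hQ⟩ := hT₀ T (le_trans (le_max_left _ _) hT)
  have hTr : (4 : ℝ) ≤ T := by exact_mod_cast hT4
  have hT1 : (1 : ℝ) ≤ T := by linarith
  have hx4 : 4 ≤ x := le_trans hTr (le_trans (le_self_pow₀ hT1 (by norm_num)) hTx)
  have hx2 : 2 ≤ x := by linarith
  have hlogT : 0 < Real.log T := Real.log_pos (by linarith)
  have hlog1 : 100 * Real.log T ≤ Real.log x := by
    have := Real.log_le_log (by positivity) hTx
    rw [Real.log_pow] at this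
    exact_mod_cast this
  have hlog2 : Real.log x ≤ 101 * Real.log T := by
    have := Real.log_le_log (by positivity) hxT
    rw [Real.log_pow] at this
    exact_mod_cast this
  have hmono : ∀ {i j : ℕ}, i ≤ j → T ^ i ≤ T ^ j := fun h => Nat.pow_le_pow_right (by omega) h
  obtain ⟨M, hM⟩ : ∃ M, M = Ioc (T ^ 4) (T ^ 8) := ⟨_, rfl⟩
  obtain ⟨P, hPdef⟩ : ∃ P, P = (Ioc (T ^ 49) (T ^ 50)).filter Nat.Prime := ⟨_, rfl⟩
  rw [← hPdef] at hP
  -- The `- 1` makes q < T^48 strict, as unique factorisation through `C = T ^ 48` requires.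
  obtain ⟨Q, hQdef⟩ : ∃ Q, Q = (Ioc (T ^ 30) (T ^ 48 - 1)).filter Nat.Prime := ⟨_, rfl⟩
  obtain ⟨S, hS⟩ : ∃ S, S = ((M ×ˢ P) ×ˢ Q).filter fun t => t.1.1 * t.1.2 * t.2 ≤ ⌊x⌋₊ := ⟨_, rfl⟩
  have hTpow : 0 < T ^ 48 := by positivity
  have hinj : Set.InjOn (fun t : (ℕ × ℕ) × ℕ => t.1.1 * t.1.2 * t.2) S := by
    refine (injOn_mul_prime_mul_prime (C := T ^ 48) (hmono (by norm_num : 8 ≤ 30))).mono fun t ht => ?_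
    simp only [hS, hM, hPdef, hQdef, coe_filter, mem_product, mem_filter, mem_Ioc,
      Set.mem_ofPred_eq] at ht ⊢
    have := hmono (by norm_num : 48 ≤ 49)
    exact ⟨⟨by omega, ht.1.1.1.2⟩, ⟨ht.1.1.2.2, by omega⟩, ht.1.2.2, ht.1.2.1.1, by omega⟩
  have hsub : S.image (fun t : (ℕ × ℕ) × ℕ => t.1.1 * t.1.2 * t.2) ⊆ Icc 1 ⌊x⌋₊ := by
    intro n hn
    obtain ⟨t, ht, rfl⟩ := mem_image.1 hn
    simp only [hS, hM, hPdef, hQdef, mem_product, mem_filter, mem_Ioc] at ht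
    refine mem_Icc.2 ⟨Nat.mul_pos (Nat.mul_pos (by omega) ht.1.1.2.2.pos) ht.1.2.2.pos, ht.2⟩
  have hQcard : ∀ m ∈ M, ∀ p ∈ P, x / (m * p) / (1000 * Real.log T) ≤
      (Q.filter fun q => m * p * q ≤ ⌊x⌋₊).card := by
    intro m hm p hp
    simp only [hM, hPdef, mem_filter, mem_Ioc] at hm hp
    have hm0 : (0 : ℝ) < m := by exact_mod_cast (by omega : 0 < m)
    have hp0 : (0 : ℝ) < p := by exact_mod_cast hp.2.pos
    have hm1 : (T : ℝ) ^ 4 < m := by exact_mod_cast hm.1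
    have hm2 : (m : ℝ) ≤ (T : ℝ) ^ 8 := by exact_mod_cast hm.2
    have hp1 : (T : ℝ) ^ 49 < p := by exact_mod_cast hp.1.1
    have hp2 : (p : ℝ) ≤ (T : ℝ) ^ 50 := by exact_mod_cast hp.1.2
    have hy1 : (T : ℝ) ^ 42 ≤ x / (m * p) := by
      rw [le_div_iff₀ (by positivity)]
      calc (T : ℝ) ^ 42 * (m * p) ≤ (T : ℝ) ^ 42 * ((T : ℝ) ^ 8 * (T : ℝ) ^ 50) := by gcongr
        _ = (T : ℝ) ^ 100 := by ring
        _ ≤ x := hTx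
    have hy2 : x / (m * p) < (T : ℝ) ^ 48 := by
      rw [div_lt_iff₀ (by positivity)]
      calc x ≤ (T : ℝ) ^ 101 := hxT
        _ = (T : ℝ) ^ 48 * ((T : ℝ) ^ 4 * (T : ℝ) ^ 49) := by ring
        _ < (T : ℝ) ^ 48 * (m * p) := by gcongr
    refine (hQ _ hy1 (hy2.le.trans (pow_le_pow_right₀ hT1 (by norm_num)))).trans ?_
    norm_cast
    refine card_le_card fun q hq => ?_
    simp only [hQdef, mem_filter, mem_Ioc] at hq ⊢
    have hqx : (q : ℝ) ≤ x / (m * p) :=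
      (Nat.le_floor_iff (by positivity)).1 (by exact_mod_cast hq.1.2)
    have hqT : q < T ^ 48 := by exact_mod_cast hqx.trans_lt hy2
    refine ⟨⟨⟨hq.1.1, by omega⟩, hq.2⟩, Nat.le_floor ?_⟩
    rw [le_div_iff₀ (by positivity)] at hqx
    push_cast
    linarith
  -- Squaring the harmonic sum over (T^2, T^4] yields divisor sums exactly over (T^4, T^8].
  have hH : Real.log T ≤ ∑ a ∈ Ioc (T ^ 2) (T ^ 4), (1 : ℝ) / a := by
    refine le_trans ?_ (log_le_sum_Ioc_inv (hmono (by norm_num)))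
    rw [← Real.log_div (by positivity) (by positivity)]
    refine Real.log_le_log (by positivity) ?_
    rw [le_div_iff₀ (by positivity)]
    push_cast
    nlinarith [pow_le_pow_right₀ hT1 (by norm_num : 1 ≤ 3), pow_nonneg (by linarith : (0 : ℝ) ≤ T) 3]
  have hD : Real.log T ^ 2 ≤ ∑ m ∈ M, (m.divisors.card : ℝ) / m := by
    have h1 := sum_inv_sq_le_sum_card_divisors (T ^ 2) (T ^ 4)
    rw [← pow_mul, ← pow_mul] at h1
    rw [hM]
    exact (pow_le_pow_left₀ hlogT.le hH 2).trans h1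
  -- 161600000 = 101 · 2000 · 800: from log x ≤ 101 log T, the prime count with d(m)/2, and the sum
  -- of 1/p.
  calc 1 / 161600000 * (x * Real.log x)
      ≤ 1 / 161600000 * (x * (101 * Real.log T)) := by gcongr
    _ = x / (2000 * Real.log T) * (Real.log T ^ 2 * (1 / 800)) := by
        have hne := hlogT.ne'
        have h1 : x / (2000 * Real.log T) * (Real.log T ^ 2 * (1 / 800)) =
            x / 2000 * (1 / 800) * (Real.log T * (Real.log T / Real.log T)) := by ring
        rw [h1, div_self hne]
        ring
    _ ≤ x / (2000 * Real.log T) *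
          ((∑ m ∈ M, (m.divisors.card : ℝ) / m) * ∑ p ∈ P, (1 : ℝ) / p) :=
        mul_le_mul_of_nonneg_left (mul_le_mul hD hP (by norm_num) ((sq_nonneg _).trans hD))
          (div_nonneg (by linarith) (by linarith))
    _ = ∑ t ∈ M ×ˢ P, x / (2000 * Real.log T) *
          ((t.1.divisors.card : ℝ) / t.1 * (1 / t.2)) := by
        rw [sum_mul_sum, ← sum_product', mul_sum]
    _ ≤ ∑ t ∈ M ×ˢ P, ∑ q ∈ Q, if t.1 * t.2 * q ≤ ⌊x⌋₊ then l (t.1 * t.2 * q) else 0 := by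
        refine sum_le_sum fun t ht => ?_
        obtain ⟨hm, hp⟩ := mem_product.1 ht
        have hcard := hQcard _ hm _ hp
        rw [← sum_filter]
        simp only [hM, hPdef, mem_filter, mem_Ioc] at hm hp
        have hm0 : (0 : ℝ) < t.1 := by exact_mod_cast (by omega : 0 < t.1)
        have hmT : (t.1 : ℝ) ≤ (T : ℝ) ^ 8 := by exact_mod_cast hm.2
        have hpT : (t.2 : ℝ) ≤ (T : ℝ) ^ 50 := by exact_mod_cast hp.1.2
        calc x / (2000 * Real.log T) * ((t.1.divisors.card : ℝ) / t.1 * (1 / t.2))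
            = x / (t.1 * t.2) / (1000 * Real.log T) * ((t.1.divisors.card : ℝ) / 2) := by
              have hp0 : (0 : ℝ) < t.2 := by exact_mod_cast hp.2.pos
              rw [div_div, div_mul_div_comm, div_mul_div_comm, div_mul_div_comm,
                div_eq_div_iff (by positivity) (by positivity)]
              ring
          _ ≤ (Q.filter fun q => t.1 * t.2 * q ≤ ⌊x⌋₊).card *
                ((t.1.divisors.card : ℝ) / 2) := by gcongr
          _ = ∑ q ∈ Q with t.1 * t.2 * q ≤ ⌊x⌋₊, ((t.1.divisors.card : ℝ) / 2) := by
              rw [sum_const, nsmul_eq_mul]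
          _ ≤ _ := by
              refine sum_le_sum fun q hq => ?_
              simp only [hQdef, mem_filter, mem_Ioc] at hq
              have := hmono (by norm_num : 48 ≤ 49)
              have := hmono (by norm_num : 8 ≤ 30)
              refine hl.le_mul_prime_mul_prime hx2 hpos (by omega) ?_ hp.2 ?_ hq.1.2 (by omega)
                (by omega)
              · have h := Real.log_le_log hm0 hmT
                rw [Real.log_pow] at h
                push_cast at h
                linarith
              · calc (t.2 : ℝ) ^ 2 ≤ ((T : ℝ) ^ 50) ^ 2 := by gcongr
                  _ = (T : ℝ) ^ 100 := by ring
                  _ ≤ x := hTx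
    _ = ∑ t ∈ S, l (t.1.1 * t.1.2 * t.2) := by
        rw [hS, sum_filter, sum_product (s := M ×ˢ P) (t := Q)]
    _ = ∑ n ∈ S.image (fun t : (ℕ × ℕ) × ℕ => t.1.1 * t.1.2 * t.2), l n := by
        rw [sum_image hinj]
    _ ≤ _ := by
        refine sum_le_sum_of_subset_of_nonneg hsub fun n hn _ => ?_
        obtain ⟨hn1, hn2⟩ := mem_Icc.1 hn
        exact hpos n hn1 ((Nat.le_floor_iff (by linarith)).1 hn2)

/-- A Hecke multiplicative function which is nonnegative on `[1, x]` has a sum of order at least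
`x log x` there. -/
theorem exists_le_sum_of_nonneg : ∃ c : ℝ, 0 < c ∧ ∀ l : ℕ → ℝ, IsHeckeMultiplicative l →
    ∀ x : ℝ, 2 ≤ x → (∀ n : ℕ, 1 ≤ n → (n : ℝ) ≤ x → 0 ≤ l n) →
    c * (x * Real.log x) ≤ ∑ n ∈ Icc 1 ⌊x⌋₊, l n := by
  obtain ⟨T₀, hT₀⟩ := exists_le_sum_of_pow_le
  -- T ≥ 2^100 ensures (2T)^100 ≤ T^101, so T = ⌊x^(1/100)⌋ satisfies both bounds on x.
  obtain ⟨B, hB⟩ := exists_nat_ge ((2 : ℝ) ^ 100)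
  set T₁ : ℕ := max T₀ (max B 2)
  obtain ⟨X, hX⟩ : ∃ X : ℝ, X = (T₁ : ℝ) ^ 100 := ⟨_, rfl⟩
  have hT₁2 : (2 : ℝ) ≤ T₁ := by
    have : (2 : ℕ) ≤ T₁ := le_trans (le_max_right _ _) (le_max_right _ _)
    exact_mod_cast this
  have hX2 : 2 ≤ X := hX ▸ le_trans hT₁2 (le_self_pow₀ (by linarith) (by norm_num))
  have hXlog : 0 < X * Real.log X := mul_pos (by linarith) (Real.log_pos (by linarith))
  refine ⟨min (1 / 161600000) (1 / (X * Real.log X)), lt_min (by norm_num) (by positivity),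
    fun l hl x hx hpos => ?_⟩
  have hlx : 0 < Real.log x := Real.log_pos (by linarith)
  rcases le_or_gt X x with hxX | hxX
  · refine (mul_le_mul_of_nonneg_right (min_le_left _ _) (by positivity)).trans ?_
    set T := ⌊x ^ (1 / 100 : ℝ)⌋₊ with hT
    have hx0 : 0 ≤ x := by linarith
    have hroot : (x ^ (1 / 100 : ℝ)) ^ 100 = x := by
      rw [← Real.rpow_natCast, ← Real.rpow_mul hx0]; norm_num
    have hr0 : 0 ≤ x ^ (1 / 100 : ℝ) := by positivity
    have hTT : T₁ ≤ T := by
      refine Nat.le_floor ?_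
      refine le_of_pow_le_pow_left₀ (n := 100) (by norm_num) hr0 ?_
      rw [hroot, ← hX]; exact hxX
    have hT2 : (2 : ℝ) ^ 100 ≤ T := by
      have : B ≤ T := le_trans (le_trans (le_max_left _ _) (le_max_right _ _)) hTT
      exact hB.trans (by exact_mod_cast this)
    refine hT₀ T (le_trans (le_max_left _ _) hTT) x ?_ ?_ l hl hpos
    · calc (T : ℝ) ^ 100 ≤ (x ^ (1 / 100 : ℝ)) ^ 100 := by
            gcongr; exact Nat.floor_le hr0
        _ = x := hroot
    · have hT1 : (1 : ℝ) ≤ T := le_trans (one_le_pow₀ (by norm_num)) hT2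
      calc x = (x ^ (1 / 100 : ℝ)) ^ 100 := hroot.symm
        _ ≤ (2 * (T : ℝ)) ^ 100 := by
            gcongr
            linarith [(Nat.lt_floor_add_one (x ^ (1 / 100 : ℝ))).le]
        _ = 2 ^ 100 * (T : ℝ) ^ 100 := by rw [mul_pow]
        _ ≤ (T : ℝ) * (T : ℝ) ^ 100 := by gcongr
        _ = (T : ℝ) ^ 101 := by ring
  -- For x < X the single term l 1 = 1 suffices.
  · calc min (1 / 161600000) (1 / (X * Real.log X)) * (x * Real.log x)
        ≤ 1 / (X * Real.log X) * (X * Real.log X) := by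
          refine mul_le_mul (min_le_right _ _) ?_ (by positivity) (by positivity)
          exact mul_le_mul hxX.le (Real.log_le_log (by linarith) hxX.le) hlx.le (by linarith)
      _ = l 1 := by rw [hl.map_one, one_div_mul_cancel hXlog.ne']
      _ ≤ _ := by
          refine single_le_sum (f := l) (fun n hn => ?_) (mem_Icc.2 ⟨le_rfl, Nat.le_floor (by
            push_cast; linarith)⟩)
          obtain ⟨hn1, hn2⟩ := mem_Icc.1 hn
          exact hpos n hn1 ((Nat.le_floor_iff (by linarith)).1 hn2)

end HeckeSums

/-! ### Fourier coefficients and Hecke relations. -/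

namespace HeckeSums

open Finset UpperHalfPlane Function

/-- Orthogonality of the d-th roots of unity. -/
lemma sum_range_qParam_pow {d : ℕ} (hd : 0 < d) (w : ℂ) (r : ℕ) :
    ∑ b ∈ range d, Periodic.qParam 1 ((w + b) / d) ^ r =
      if d ∣ r then (d : ℂ) * Periodic.qParam 1 w ^ (r / d) else 0 := by
  have hd0 : (d : ℂ) ≠ 0 := by exact_mod_cast hd.ne'
  set ζ : ℂ := Complex.exp (2 * Real.pi * Complex.I / d) with hζdef
  have hζ : IsPrimitiveRoot ζ d := Complex.isPrimitiveRoot_exp d hd.ne'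
  have hterm : ∀ b : ℕ, Periodic.qParam 1 ((w + b) / d) ^ r =
      Periodic.qParam 1 (w / d) ^ r * (ζ ^ r) ^ b := by
    intro b
    simp only [Periodic.qParam, hζdef, ← Complex.exp_nat_mul, ← Complex.exp_add]
    congr 1
    push_cast
    field_simp
  simp_rw [hterm, ← mul_sum]
  split_ifs with h
  · obtain ⟨s, rfl⟩ := h
    rw [Nat.mul_div_cancel_left _ hd, pow_mul ζ, hζ.pow_eq_one]
    simp only [one_pow, sum_const, card_range, nsmul_eq_mul, mul_one]
    rw [mul_comm]
    congr 1
    simp only [Periodic.qParam, ← Complex.exp_nat_mul]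
    congr 1
    push_cast
    field_simp
  · have h1 : ζ ^ r ≠ 1 := fun h1 => h ((hζ.pow_eq_one_iff_dvd r).1 h1)
    rw [geom_sum_eq h1, ← pow_mul, mul_comm r d, pow_mul, hζ.pow_eq_one, one_pow, sub_self,
      zero_div, mul_zero]

lemma hasSum_sum_shift {F : ℍ → ℂ} {A : ℕ → ℂ}
    (hF : ∀ τ : ℍ, HasSum (fun m => A m * Periodic.qParam 1 τ ^ m) (F τ))
    {a d : ℕ} (ha : 0 < a) (hd : 0 < d) (τ : ℍ) :
    HasSum (fun m => (if a ∣ m then (d : ℂ) * A (d * (m / a)) else 0) * Periodic.qParam 1 τ ^ m)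
      (∑ b ∈ range d, F (ofComplex (((a : ℂ) * (τ : ℂ) + b) / d))) := by
  have ha' : (0 : ℝ) < a := by exact_mod_cast ha
  have hd' : (0 : ℝ) < d := by exact_mod_cast hd
  have him : ∀ b : ℕ, 0 < (((a : ℂ) * (τ : ℂ) + b) / d).im := by
    intro b
    rw [Complex.div_natCast_im]
    simp only [Complex.add_im, Complex.mul_im, Complex.natCast_re, Complex.natCast_im, zero_mul,
      add_zero, coe_im]
    exact div_pos (mul_pos ha' τ.im_pos) hd'
  have h1 := hasSum_sum (s := range d)
    fun b _ => hF (ofComplex (((a : ℂ) * (τ : ℂ) + b) / d))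
  simp_rw [ofComplex_apply_of_im_pos (him _)] at h1 ⊢
  simp only [← mul_sum] at h1
  simp_rw [sum_range_qParam_pow hd] at h1
  have h2 : HasSum (fun s => (d : ℂ) * A (d * s) * Periodic.qParam 1 (a * (τ : ℂ)) ^ s)
      (∑ b ∈ range d, F ⟨((a : ℂ) * (τ : ℂ) + b) / d, him b⟩) := by
    have hinj : Injective fun s : ℕ => d * s := fun s t h => Nat.eq_of_mul_eq_mul_left hd h
    refine (hinj.hasSum_iff (f := fun r => A r * if d ∣ r then
      (d : ℂ) * Periodic.qParam 1 (a * (τ : ℂ)) ^ (r / d) else 0) ?_).2 h1 |>.congr_fun ?_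
    · intro r hr
      have : ¬ d ∣ r := fun ⟨s, hs⟩ => hr ⟨s, hs.symm⟩
      simp [this]
    · intro s
      simp [Nat.mul_div_cancel_left _ hd]
      ring
  have hinj : Injective fun s : ℕ => a * s := fun s t h => Nat.eq_of_mul_eq_mul_left ha h
  refine (hinj.hasSum_iff ?_).1 ?_
  · intro r hr
    have : ¬ a ∣ r := fun ⟨s, hs⟩ => hr ⟨s, hs.symm⟩
    simp [this]
  · convert h2 using 2 with s
    simp only [comp_apply, dvd_mul_right, if_true, Nat.mul_div_cancel_left _ ha]
    congr 1
    simp only [Periodic.qParam, ← Complex.exp_nat_mul]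
    congr 1
    push_cast
    ring

variable {k : ℤ} {f : CuspForm 𝒮ℒ k}

/-- Expand the eigenvalue equation termwise and use uniqueness of the q-expansion of μ f; modularity
of T_n f is not needed separately. The powers combine as n^(k-1) d^(-k) d = a^(k-1). -/
lemma hecke_coeff {n : ℕ} {μ : ℂ}
    (hμ : ∀ z : ℍ, heckeOperator k n f z = μ * f z) (m : ℕ) :
    μ * (qExpansion 1 f).coeff m = ∑ ad ∈ n.divisorsAntidiagonal,
      if ad.1 ∣ m then (ad.1 : ℂ) ^ (k - 1) * (qExpansion 1 f).coeff (ad.2 * (m / ad.1)) else 0 := by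
  set A : ℕ → ℂ := fun m => (qExpansion 1 f).coeff m with hA
  have hF : ∀ τ : ℍ, HasSum (fun m => A m * Periodic.qParam 1 τ ^ m) (f τ) :=
    ModularForm.hasSum_qExpansion f one_pos one_mem_strictPeriods_SL
  have hsum : ∀ τ : ℍ, HasSum (fun m => ((n : ℂ) ^ (k - 1) * ∑ ad ∈ n.divisorsAntidiagonal,
      (ad.2 : ℂ) ^ (-k) * if ad.1 ∣ m then (ad.2 : ℂ) * A (ad.2 * (m / ad.1)) else 0) •
        Periodic.qParam 1 τ ^ m) ((μ • f) τ) := by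
    intro τ
    have h1 : HasSum _ (heckeOperator k n f τ) := HasSum.mul_left _ (hasSum_sum fun ad had =>
      (hasSum_sum_shift hF (Nat.pos_of_mem_divisors (Nat.fst_mem_divisors_of_mem_antidiagonal had))
        (Nat.pos_of_mem_divisors (Nat.snd_mem_divisors_of_mem_antidiagonal had)) τ).mul_left
        ((ad.2 : ℂ) ^ (-k)))
    rw [hμ] at h1
    convert h1 using 2 with m
    simp only [smul_eq_mul, mul_sum, sum_mul]
    · exact sum_congr rfl fun ad _ => by ring
    · rfl
  have huniq := ModularFormClass.qExpansion_coeff_unique one_pos one_mem_strictPeriods_SL hsum m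
  have hsmul : (qExpansion 1 (μ • f)).coeff m = μ * A m := by
    have := ModularForm.qExpansion_smul one_pos one_mem_strictPeriods_SL μ f
    simp [this, hA]
  have h2 : μ * A m = _ := hsmul.symm.trans huniq.symm
  rw [h2, mul_sum]
  refine sum_congr rfl fun ad had => ?_
  have hd : (ad.2 : ℂ) ≠ 0 := by
    exact_mod_cast (Nat.pos_of_mem_divisors (Nat.snd_mem_divisors_of_mem_antidiagonal had)).ne'
  split_ifs
  · rw [← (Nat.mem_divisorsAntidiagonal.1 had).1]
    push_cast
    rw [mul_zpow, zpow_neg, zpow_sub_one₀ hd]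
    field_simp
    rfl
  · simp

namespace IsHeckeCuspForm

/-- In the first coefficient only a = 1 survives, which identifies the eigenvalue. -/
lemma heckeOperator_eq (hf : IsHeckeCuspForm f) {n : ℕ} (hn : 1 ≤ n) (z : ℍ) :
    heckeOperator k n f z = (qExpansion 1 f).coeff n * f z := by
  obtain ⟨μ, hμ⟩ := hf.eigenform n hn
  have h := hecke_coeff hμ 1
  rw [hf.coeff_one, mul_one, sum_eq_single (1, n)] at h
  · simp only [dvd_refl, if_true, Nat.cast_one, one_zpow, one_mul, Nat.div_one, mul_one] at h
    rw [hμ, h]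
  · intro ad had hne
    rw [if_neg]
    intro h1
    have h2 := Nat.dvd_one.1 h1
    have h3 := (Nat.mem_divisorsAntidiagonal.1 had).1
    rw [h2, one_mul] at h3
    exact hne (Prod.ext h2 h3)
  · intro h
    exact absurd (Nat.mem_divisorsAntidiagonal.2 ⟨one_mul n, by omega⟩) h

lemma coeff_mul_coeff (hf : IsHeckeCuspForm f) {n : ℕ} (hn : 1 ≤ n) (m : ℕ) :
    (qExpansion 1 f).coeff n * (qExpansion 1 f).coeff m = ∑ ad ∈ n.divisorsAntidiagonal,
      if ad.1 ∣ m then (ad.1 : ℂ) ^ (k - 1) * (qExpansion 1 f).coeff (ad.2 * (m / ad.1)) else 0 :=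
  hecke_coeff (hf.heckeOperator_eq hn) m

lemma coeff_mul_of_coprime (hf : IsHeckeCuspForm f) {m n : ℕ} (hm : 1 ≤ m) (hmn : m.Coprime n) :
    (qExpansion 1 f).coeff (m * n) = (qExpansion 1 f).coeff m * (qExpansion 1 f).coeff n := by
  rw [hf.coeff_mul_coeff hm, sum_eq_single (1, m)]
  · simp
  · intro ad had hne
    rw [if_neg]
    intro h1
    have h3 := (Nat.mem_divisorsAntidiagonal.1 had).1
    have h2 : ad.1 = 1 := Nat.eq_one_of_dvd_coprimes hmn ⟨ad.2, h3.symm⟩ h1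
    rw [h2, one_mul] at h3
    exact hne (Prod.ext h2 h3)
  · intro h
    exact absurd (Nat.mem_divisorsAntidiagonal.2 ⟨one_mul m, by omega⟩) h

lemma coeff_prime_mul_coeff_pow (hf : IsHeckeCuspForm f) {p : ℕ} (hp : p.Prime) (j : ℕ) :
    (qExpansion 1 f).coeff p * (qExpansion 1 f).coeff (p ^ (j + 1)) =
      (qExpansion 1 f).coeff (p ^ (j + 2)) + (p : ℂ) ^ (k - 1) * (qExpansion 1 f).coeff (p ^ j) := by
  rw [hf.coeff_mul_coeff hp.one_le, Nat.sum_divisorsAntidiagonal fun a d => if a ∣ p ^ (j + 1) then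
    (a : ℂ) ^ (k - 1) * (qExpansion 1 f).coeff (d * (p ^ (j + 1) / a)) else 0, hp.sum_divisors]
  have h1 : p ∣ p ^ (j + 1) := dvd_pow_self p (by omega)
  have h2 : p ^ (j + 1) / p = p ^ j := by rw [pow_succ, Nat.mul_div_cancel _ hp.pos]
  simp only [h1, h2, if_true, one_dvd, Nat.div_one, Nat.div_self hp.pos, Nat.cast_one, one_zpow,
    one_mul, ← pow_succ']
  exact add_comm _ _

lemma lam_one (hf : IsHeckeCuspForm f) : lam f 1 = 1 := by
  simp [lam, hf.coeff_one]

lemma lam_mul (hf : IsHeckeCuspForm f) {m n : ℕ} (hm : 1 ≤ m) (hmn : m.Coprime n) :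
    lam f (m * n) = lam f m * lam f n := by
  simp only [lam]
  rw [hf.coeff_mul_of_coprime hm hmn, Nat.cast_mul,
    Real.mul_rpow (Nat.cast_nonneg m) (Nat.cast_nonneg n), Complex.ofReal_mul, div_mul_div_comm]

lemma lam_prime_mul_lam_pow (hf : IsHeckeCuspForm f) {p : ℕ} (hp : p.Prime) (j : ℕ) :
    lam f p * lam f (p ^ (j + 1)) = lam f (p ^ (j + 2)) + lam f (p ^ j) := by
  simp only [lam]
  have hp0 : (0 : ℝ) < p := by exact_mod_cast hp.pos
  set w : ℝ := (p : ℝ) ^ (((k : ℝ) - 1) / 2) with hw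
  have hw0 : (w : ℂ) ≠ 0 := by exact_mod_cast (Real.rpow_pos_of_pos hp0 _).ne'
  have hpow : ∀ i : ℕ, (((p ^ i : ℕ) : ℝ) ^ (((k : ℝ) - 1) / 2)) = w ^ i := by
    intro i
    push_cast
    rw [hw, ← Real.rpow_natCast, ← Real.rpow_natCast, ← Real.rpow_mul hp0.le,
      ← Real.rpow_mul hp0.le, mul_comm]
  have hw2 : (p : ℂ) ^ (k - 1) = (w : ℂ) ^ 2 := by
    have h : (p : ℝ) ^ (k - 1) = w ^ 2 := by
      rw [hw, ← Real.rpow_natCast, ← Real.rpow_mul hp0.le, ← Real.rpow_intCast]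
      push_cast
      congr 1
      ring
    rw [← Complex.ofReal_pow, ← h]
    push_cast
    rfl
  rw [hpow, hpow, hpow, div_mul_div_comm, hf.coeff_prime_mul_coeff_pow hp, hw2]
  push_cast
  field_simp
  ring

end IsHeckeCuspForm

end HeckeSums

/-! ### A weight on the fundamental domain, and its volume. -/

namespace HeckeSums

open Finset UpperHalfPlane Function MeasureTheory ModularGroup
open scoped Modular ENNReal

/-- Finiteness allows counting the returns of an orbit to the closed domain, including boundary
identifications. -/
lemma exists_finset_smul_mem_fd :
    ∃ F : Finset SL(2, ℤ), ∀ z ∈ 𝒟, ∀ g : SL(2, ℤ), g • z ∈ 𝒟 → g ∈ F := by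
  classical
  refine ⟨{1, -1, T, -T, T⁻¹, -T⁻¹, S, -S, T * S, -(T * S), T⁻¹ * S * T⁻¹, -(T⁻¹ * S * T⁻¹),
    S * T⁻¹, -(S * T⁻¹), S * T, -(S * T), T * S * T, -(T * S * T), T⁻¹ * S, -(T⁻¹ * S)},
    fun z hz g hg => ?_⟩
  rcases cases_of_mem_fd_smul_mem_fd hz hg with (h | h) | ⟨h | h, -⟩ | ⟨h | h, -⟩ | ⟨h | h, -⟩ |
    ⟨h | h, -⟩ | ⟨h | h, -⟩ | ⟨h | h, -⟩ | ⟨h | h, -⟩ | ⟨h | h, -⟩ | ⟨h | h, -⟩ <;>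
  simp only [h, Finset.mem_insert, Finset.mem_singleton, eq_self, true_or, or_true]

lemma measurable_SL_smul (g : SL(2, ℤ)) : Measurable fun z : ℍ => g • z :=
  (continuous_const_smul (g : GL (Fin 2) ℝ)).measurable

/-- A weight function on the upper half plane, supported in the standard fundamental domain, whose
translates by the modular group add up to one. -/
lemma exists_partition_of_unity : ∃ χ : ℍ → ℝ, Measurable χ ∧ (∀ z, 0 ≤ χ z) ∧ (∀ z, χ z ≤ 1) ∧
    (∀ z, z ∉ 𝒟 → χ z = 0) ∧ ∀ z, HasSum (fun g : SL(2, ℤ) => χ (g • z)) 1 := by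
  classical
  obtain ⟨F, hF⟩ := exists_finset_smul_mem_fd
  -- Right translation by h shows that the count is constant on the points of an orbit in 𝒟; its
  -- inverse is therefore the right weight. The count includes -1, which acts trivially.
  have hcard : ∀ z ∈ 𝒟, ∀ h : SL(2, ℤ), h • z ∈ 𝒟 →
      (F.filter fun g => g • h • z ∈ 𝒟).card = (F.filter fun g => g • z ∈ 𝒟).card := by
    intro z hz h hh
    refine card_bij (fun g _ => g * h) (fun g hg => ?_) (fun a _ b _ hab => mul_right_cancel hab)
      fun g hg => ⟨g * h⁻¹, ?_, by group⟩
    · have h1 : (g * h) • z ∈ 𝒟 := by rw [mul_smul]; exact (mem_filter.1 hg).2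
      exact mem_filter.2 ⟨hF z hz _ h1, h1⟩
    · have h1 : (g * h⁻¹) • h • z ∈ 𝒟 := by
        rw [← mul_smul, inv_mul_cancel_right]; exact (mem_filter.1 hg).2
      exact mem_filter.2 ⟨hF _ hh _ h1, h1⟩
  have hpos : ∀ z ∈ 𝒟, 0 < (F.filter fun g => g • z ∈ 𝒟).card := fun z hz =>
    card_pos.2 ⟨1, mem_filter.2 ⟨hF z hz 1 (by rwa [one_smul]), by rwa [one_smul]⟩⟩
  refine ⟨Set.indicator 𝒟 fun z => ((F.filter fun g => g • z ∈ 𝒟).card : ℝ)⁻¹, ?_, ?_, ?_, ?_, ?_⟩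
  · refine Measurable.indicator (Measurable.inv ?_) isClosed_fd.measurableSet
    simp_rw [card_filter]
    push_cast
    refine Finset.measurable_sum _ fun g _ => Measurable.ite ?_ measurable_const measurable_const
    exact measurable_SL_smul g isClosed_fd.measurableSet
  · exact fun z => Set.indicator_nonneg (fun _ _ => by positivity) z
  · intro z
    refine Set.indicator_le' (fun z hz => ?_) (fun _ _ => zero_le_one) z
    exact inv_le_one_of_one_le₀ (by exact_mod_cast hpos z hz)
  · exact fun z hz => Set.indicator_of_notMem hz _
  · intro z
    obtain ⟨h, hh⟩ := exists_smul_mem_fd z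
    rw [← (Equiv.mulRight h).hasSum_iff]
    simp only [comp_def, Equiv.coe_mulRight, mul_smul]
    set w := h • z
    have h1 : ∑ g ∈ F.filter fun g => g • w ∈ 𝒟,
        Set.indicator 𝒟 (fun z => ((F.filter fun g => g • z ∈ 𝒟).card : ℝ)⁻¹) (g • w) = 1 := by
      have h2 : ∀ g ∈ F.filter fun g => g • w ∈ 𝒟,
          Set.indicator 𝒟 (fun z => ((F.filter fun g => g • z ∈ 𝒟).card : ℝ)⁻¹) (g • w) =
            ((F.filter fun g => g • w ∈ 𝒟).card : ℝ)⁻¹ := by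
        intro g hg
        have hg' := (mem_filter.1 hg).2
        rw [Set.indicator_of_mem hg', hcard w hh g hg']
      rw [sum_congr rfl h2, sum_const, nsmul_eq_mul, mul_inv_cancel₀]
      exact_mod_cast (hpos w hh).ne'
    rw [← h1]
    refine hasSum_sum_of_ne_finset_zero fun g hg => Set.indicator_of_notMem ?_ _
    exact fun hgw => hg (mem_filter.2 ⟨hF w hh g hgw, hgw⟩)

/-- The domain lies in |Re z| ≤ 1, Im z > 1/2, where y^(-2) is integrable. -/
lemma volume_fd_lt_top : volume (𝒟 : Set ℍ) < ∞ := by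
  rw [volume_eq_lintegral]
  have hsub : ((↑) : ℍ → ℂ) '' 𝒟 ⊆ Complex.measurableEquivRealProd ⁻¹'
      (Set.Icc (-1) 1 ×ˢ Set.Ioi (1 / 2)) := by
    rintro _ ⟨z, hz, rfl⟩
    have h1 := three_le_four_mul_im_sq_of_mem_fd hz
    have h2 := abs_le.1 hz.2
    simp only [Set.mem_preimage, Complex.measurableEquivRealProd_apply, Set.mem_prod, Set.mem_Icc,
      Set.mem_Ioi, coe_re, coe_im]
    exact ⟨⟨by linarith, by linarith⟩, by nlinarith [z.im_pos]⟩
  refine (lintegral_mono_set hsub).trans_lt ?_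
  have hint : IntegrableOn (fun p : ℝ × ℝ => (1 : ℝ) * p.2 ^ (-2 : ℝ))
      (Set.Icc (-1) 1 ×ˢ Set.Ioi (1 / 2)) := by
    rw [IntegrableOn, Measure.volume_eq_prod, ← Measure.prod_restrict]
    refine Integrable.mul_prod (f := fun _ : ℝ => (1 : ℝ)) (g := fun y : ℝ => y ^ (-2 : ℝ)) ?_ ?_
    · exact integrableOn_const (by simp)
    · exact integrableOn_Ioi_rpow_of_lt (by norm_num) (by norm_num)
  have h1 := hint.2
  rw [hasFiniteIntegral_iff_enorm] at h1
  have hmp := Complex.volume_preserving_equiv_real_prod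
  rw [← hmp.setLIntegral_comp_preimage_emb Complex.measurableEquivRealProd.measurableEmbedding]
    at h1
  refine lt_of_le_of_lt (setLIntegral_mono' ?_ fun z hz => ?_) h1
  · exact Complex.measurableEquivRealProd.measurable (measurableSet_Icc.prod measurableSet_Ioi)
  · simp only [Set.mem_preimage, Complex.measurableEquivRealProd_apply, Set.mem_prod,
      Set.mem_Ioi] at hz ⊢
    have hz0 : 0 < z.im := by linarith [hz.2]
    rw [one_mul, enorm_eq_nnnorm]
    norm_cast
    rw [← NNReal.coe_le_coe]
    simp only [NNReal.coe_pow, NNReal.coe_div, coe_nnnorm, NNReal.coe_one]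
    rw [Real.norm_of_nonneg hz0.le, Real.norm_of_nonneg (by positivity)]
    simp

lemma volume_pos_of_isOpen {U : Set ℍ} (hU : IsOpen U) (hne : U.Nonempty) : 0 < volume U := by
  rw [volume_eq_lintegral]
  have hopen : IsOpen (((↑) : ℍ → ℂ) '' U) := isOpenEmbedding_coe.isOpenMap U hU
  rw [setLIntegral_pos_iff (by fun_prop)]
  refine lt_of_lt_of_le (hopen.measure_pos volume (hne.image _)) (measure_mono fun z hz => ?_)
  refine ⟨?_, hz⟩
  obtain ⟨w, -, rfl⟩ := hz
  simp [w.im_ne_zero]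

end HeckeSums

/-! ### Integral matrices of determinant n. -/

namespace HeckeSums

open Finset UpperHalfPlane Function MeasureTheory ModularGroup FixedDetMatrices
open scoped Modular ENNReal ModularForm

variable {n : ℕ}

instance : Countable (FixedDetMatrix (Fin 2) ℤ n) :=
  inferInstanceAs (Countable {A : Fin 2 → Fin 2 → ℤ // Matrix.det A = n})

instance : Countable SL(2, ℤ) :=
  inferInstanceAs (Countable {A : Fin 2 → Fin 2 → ℤ // Matrix.det A = 1})

lemma exists_reduce_eq_smul {m : ℤ} (A : FixedDetMatrix (Fin 2) ℤ m) :
    ∃ g : SL(2, ℤ), reduce A = g • A := by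
  induction A using reduce_rec with
  | base A h =>
    by_cases h0 : 0 < A.1 0 0
    · exact ⟨_, reduce_of_pos h h0⟩
    · exact ⟨_, (reduce_of_not_pos h h0).trans (by rw [← mul_smul, ← mul_smul])⟩
  | step A h ih =>
    obtain ⟨g, hg⟩ := ih
    rw [reduce_reduceStep h] at hg
    exact ⟨_, hg.trans (by rw [reduceStep, ← mul_smul, ← mul_smul])⟩

/-- The index set of the upper triangular representatives of `SL(2, ℤ)`-orbits of integral matrices
of determinant `n`. -/
abbrev CosetIndex (n : ℕ) : Type :=
  ↥(n.divisorsAntidiagonal.sigma fun ad => range ad.2)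

/-- The upper triangular matrix with rows `(a, b)` and `(0, d)`. -/
def cosetRep (i : CosetIndex n) : FixedDetMatrix (Fin 2) ℤ n :=
  ⟨!![(i.1.1.1 : ℤ), i.1.2; 0, i.1.1.2], by
    have h := (Nat.mem_divisorsAntidiagonal.1 (mem_sigma.1 i.2).1).1
    rw [Matrix.det_fin_two_of, mul_zero, sub_zero]
    exact_mod_cast h⟩

lemma coe_cosetRep (i : CosetIndex n) :
    (cosetRep i).1 = !![(i.1.1.1 : ℤ), i.1.2; 0, i.1.1.2] := rfl

/-- The matrix `h⁻¹ * g` carries one representative to another, so it is upper triangular; positive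
diagonals make it unipotent, and 0 ≤ b < d leaves only the identity. -/
lemma cosetRep_smul_injective :
    Injective fun p : CosetIndex n × SL(2, ℤ) => p.2 • cosetRep p.1 := by
  rintro ⟨i, g⟩ ⟨j, h⟩ hij
  simp only at hij
  have hi := mem_sigma.1 i.2
  have hj := mem_sigma.1 j.2
  rw [Nat.mem_divisorsAntidiagonal, mem_range] at hi hj
  have key : (h⁻¹ * g) • cosetRep i = cosetRep j := by
    rw [mul_smul, hij, inv_smul_smul]
  set u := h⁻¹ * g with hu
  have hmat := congrArg Subtype.val key
  rw [smul_coe] at hmat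
  have hdet := u.2
  rw [Matrix.det_fin_two] at hdet
  have e00 := congrFun (congrFun hmat 0) 0
  have e01 := congrFun (congrFun hmat 0) 1
  have e10 := congrFun (congrFun hmat 1) 0
  have e11 := congrFun (congrFun hmat 1) 1
  simp only [cosetRep, Matrix.mul_apply, Fin.sum_univ_two, Matrix.of_apply, Matrix.cons_val_zero,
    Matrix.cons_val_one, Matrix.cons_val', Matrix.cons_val_fin_one, mul_zero, add_zero] at e00 e01 e10 e11
  have hn0 : n ≠ 0 := hi.1.2
  have ha : 0 < i.1.1.1 := Nat.pos_of_ne_zero fun h0 => hn0 (by rw [← hi.1.1, h0, zero_mul])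
  have ha' : 0 < j.1.1.1 := Nat.pos_of_ne_zero fun h0 => hn0 (by rw [← hj.1.1, h0, zero_mul])
  have u10 : u.1 1 0 = 0 := by
    rcases mul_eq_zero.1 e10 with h0 | h0
    · exact h0
    · exact absurd h0 (by exact_mod_cast ha.ne')
  rw [u10, mul_zero, sub_zero] at hdet
  have u00 : u.1 0 0 = 1 := by
    rcases Int.eq_one_or_neg_one_of_mul_eq_one hdet with h0 | h0
    · exact h0
    · rw [h0] at e00
      omega
  have u11 : u.1 1 1 = 1 := by rwa [u00, one_mul] at hdet
  rw [u00, one_mul] at e00 e01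
  rw [u10, zero_mul, zero_add, u11, one_mul] at e11
  have u01 : u.1 0 1 = 0 := by
    by_contra hne
    have hd : (i.1.1.2 : ℤ) = j.1.1.2 := e11
    have hb1 : (i.1.2 : ℤ) < i.1.1.2 := by exact_mod_cast hi.2
    have hb2 : (j.1.2 : ℤ) < j.1.1.2 := by exact_mod_cast hj.2
    rcases lt_or_gt_of_ne hne with h0 | h0 <;> nlinarith
  rw [u01, zero_mul, add_zero] at e01
  have hu1 : u = 1 := by
    ext a b
    fin_cases a <;> fin_cases b <;> simp [u00, u01, u10, u11]
  have hgh : g = h := by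
    rw [hu] at hu1
    exact (inv_mul_eq_one.1 hu1).symm
  refine Prod.ext (Subtype.ext ?_) hgh
  obtain ⟨⟨⟨a, d⟩, b⟩, _⟩ := i
  obtain ⟨⟨⟨a', d'⟩, b'⟩, _⟩ := j
  simp only [Nat.cast_inj] at e00 e01 e11
  subst e00 e01 e11
  rfl

lemma cosetRep_smul_surjective (hn : n ≠ 0) :
    Surjective fun p : CosetIndex n × SL(2, ℤ) => p.2 • cosetRep p.1 := by
  intro A
  obtain ⟨g, hg⟩ := exists_reduce_eq_smul A
  have hmem := reduce_mem_reps (by exact_mod_cast hn) A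
  obtain ⟨h10, h00, h01, h11⟩ := hmem
  set B := reduce A with hB
  have hdet := B.2
  rw [Matrix.det_fin_two, h10, mul_zero, sub_zero] at hdet
  have hd : 0 < B.1 1 1 := by
    have : 0 < B.1 0 0 * B.1 1 1 := by rw [hdet]; exact_mod_cast Nat.pos_of_ne_zero hn
    exact (mul_pos_iff_of_pos_left h00).1 this
  rw [abs_of_nonneg h01, abs_of_pos hd] at h11
  obtain ⟨a, ha⟩ := Int.eq_ofNat_of_zero_le h00.le
  obtain ⟨b, hb⟩ := Int.eq_ofNat_of_zero_le h01
  obtain ⟨d, hd'⟩ := Int.eq_ofNat_of_zero_le hd.le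
  rw [ha, hd'] at hdet
  rw [hb, hd'] at h11
  refine ⟨⟨⟨⟨(a, d), b⟩, mem_sigma.2 ⟨Nat.mem_divisorsAntidiagonal.2 ⟨by exact_mod_cast hdet, hn⟩,
    mem_range.2 (by exact_mod_cast h11)⟩⟩, g⁻¹⟩, ?_⟩
  simp only
  rw [inv_smul_eq_iff, ← hg]
  ext i j
  fin_cases i <;> fin_cases j <;> simp [cosetRep, h10, ha, hb, hd']

/-- Every integral matrix of determinant `n` is uniquely the product of an element of `SL(2, ℤ)`
and an upper triangular representative. -/
def cosetEquiv (hn : n ≠ 0) : CosetIndex n × SL(2, ℤ) ≃ FixedDetMatrix (Fin 2) ℤ n :=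
  Equiv.ofBijective _ ⟨cosetRep_smul_injective, cosetRep_smul_surjective hn⟩

/-- The adjugate, as an involution of the integral matrices of determinant `n`. -/
def adjugateEquiv (n : ℕ) : FixedDetMatrix (Fin 2) ℤ n ≃ FixedDetMatrix (Fin 2) ℤ n where
  toFun A := ⟨A.1.adjugate, by rw [Matrix.det_adjugate, A.2]; simp⟩
  invFun A := ⟨A.1.adjugate, by rw [Matrix.det_adjugate, A.2]; simp⟩
  left_inv A := ext' _ _ (by simp [Matrix.adjugate_adjugate'])
  right_inv A := ext' _ _ (by simp [Matrix.adjugate_adjugate'])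

lemma coe_adjugateEquiv (A : FixedDetMatrix (Fin 2) ℤ n) :
    (adjugateEquiv n A).1 = A.1.adjugate := rfl

variable [NeZero n]

/-- An integral matrix of nonzero determinant `n` as an element of `GL(2, ℝ)`. -/
def toGL (A : FixedDetMatrix (Fin 2) ℤ n) : GL (Fin 2) ℝ :=
  Matrix.GeneralLinearGroup.mkOfDetNeZero (A.1.map ((↑) : ℤ → ℝ)) (by
    have h : (A.1.map ((↑) : ℤ → ℝ)).det = n := by
      have := (Int.castRingHom ℝ).map_det A.1
      rw [A.2] at this
      simpa [RingHom.mapMatrix_apply] using this.symm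
    rw [h]
    exact_mod_cast NeZero.ne n)

lemma coe_toGL (A : FixedDetMatrix (Fin 2) ℤ n) :
    (toGL A : Matrix (Fin 2) (Fin 2) ℝ) = A.1.map ((↑) : ℤ → ℝ) := rfl

lemma det_toGL (A : FixedDetMatrix (Fin 2) ℤ n) : (toGL A).det.val = n := by
  rw [Matrix.GeneralLinearGroup.val_det_apply, coe_toGL]
  have := (Int.castRingHom ℝ).map_det A.1
  rw [A.2] at this
  simpa [RingHom.mapMatrix_apply] using this.symm

lemma det_toGL_pos (A : FixedDetMatrix (Fin 2) ℤ n) : 0 < (toGL A).det.val := by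
  rw [det_toGL]
  exact_mod_cast Nat.pos_of_ne_zero (NeZero.ne n)

lemma toGL_smul (g : SL(2, ℤ)) (A : FixedDetMatrix (Fin 2) ℤ n) :
    toGL (g • A) = (g : GL (Fin 2) ℝ) * toGL A := by
  ext i j
  simp [coe_toGL, smul_coe, Matrix.mul_apply]

lemma toGL_mul_toGL_adjugate (A : FixedDetMatrix (Fin 2) ℤ n) :
    toGL A * toGL (adjugateEquiv n A) =
      Matrix.GeneralLinearGroup.scalar (Fin 2) (Units.mk0 (n : ℝ) (NeZero.ne _)) := by
  have h : A.1 * A.1.adjugate = (n : ℤ) • (1 : Matrix (Fin 2) (Fin 2) ℤ) := by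
    rw [Matrix.mul_adjugate, A.2]
  ext i j
  have hij := congrArg ((↑) : ℤ → ℝ) (congrFun (congrFun h i) j)
  simp only [Matrix.GeneralLinearGroup.coe_mul, coe_toGL, coe_adjugateEquiv]
  rw [Matrix.mul_apply] at hij ⊢
  simp only [Matrix.map_apply]
  push_cast at hij
  rw [hij]
  fin_cases i <;> fin_cases j <;> simp [Matrix.natCast_apply]

end HeckeSums

/-! ### The Petersson kernel of a matrix. -/

namespace HeckeSums

open Finset UpperHalfPlane Function MeasureTheory ModularGroup FixedDetMatrices
open scoped Modular ENNReal ModularForm ComplexConjugate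

variable {n : ℕ} [NeZero n] {k : ℤ}

lemma natCast_ne_zero_of_neZero : (n : ℂ) ≠ 0 := by exact_mod_cast NeZero.ne n

lemma slash_toGL_cosetRep (F : ℍ → ℂ) (i : CosetIndex n) (z : ℍ) :
    (F ∣[k] toGL (cosetRep i)) z = (n : ℂ) ^ (k - 1) * ((i.1.1.2 : ℂ) ^ (-k) *
      F (ofComplex (((i.1.1.1 : ℂ) * (z : ℂ) + (i.1.2 : ℂ)) / (i.1.1.2 : ℂ)))) := by
  have hdenom : denom (toGL (cosetRep i)) z = i.1.1.2 := by
    simp [denom, coe_toGL, coe_cosetRep]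
  have hnum : num (toGL (cosetRep i)) z = (i.1.1.1 : ℂ) * (z : ℂ) + (i.1.2 : ℂ) := by
    simp [num, coe_toGL, coe_cosetRep]
  have hsmul : toGL (cosetRep i) • z =
      ofComplex (((i.1.1.1 : ℂ) * (z : ℂ) + (i.1.2 : ℂ)) / (i.1.1.2 : ℂ)) := by
    rw [← hnum, ← hdenom, ← coe_smul_of_det_pos (det_toGL_pos _), ofComplex_apply]
  rw [ModularForm.slash_apply, hsmul, hdenom, σ, if_pos (det_toGL_pos _), det_toGL]
  simp only [Nat.abs_cast, Complex.ofReal_natCast, ContinuousAlgEquiv.refl_apply]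
  ring

lemma sum_slash_cosetRep (F : ℍ → ℂ) (z : ℍ) :
    ∑ i : CosetIndex n, (F ∣[k] toGL (cosetRep i)) z = heckeOperator k n F z := by
  simp_rw [slash_toGL_cosetRep]
  rw [heckeOperator, Finset.sum_coe_sort (n.divisorsAntidiagonal.sigma fun ad => range ad.2)
    (fun i => (n : ℂ) ^ (k - 1) * ((i.1.2 : ℂ) ^ (-k) *
      F (ofComplex (((i.1.1 : ℂ) * (z : ℂ) + (i.2 : ℂ)) / (i.1.2 : ℂ))))), sum_sigma]
  simp_rw [← mul_sum]

variable (f : CuspForm 𝒮ℒ k)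

lemma slash_SL_eq (g : SL(2, ℤ)) : (f : ℍ → ℂ) ∣[k] (g : GL (Fin 2) ℝ) = f :=
  SlashInvariantFormClass.slash_action_eq f _ ⟨g, rfl⟩

lemma slash_scalar (F : ℍ → ℂ) :
    F ∣[k] (Matrix.GeneralLinearGroup.scalar (Fin 2) (Units.mk0 (n : ℝ) (NeZero.ne _))) =
      (n : ℂ) ^ (k - 2) • F := by
  have hn0 := natCast_ne_zero_of_neZero (n := n)
  have hdet : (Matrix.GeneralLinearGroup.scalar (Fin 2)
      (Units.mk0 (n : ℝ) (NeZero.ne _))).det.val = (n : ℝ) ^ 2 := by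
    simp [sq]
  ext z
  rw [ModularForm.slash_apply, glScalar_smul, denom_scalar, hdet, σ,
    if_pos (by rw [hdet]; have := NeZero.ne n; positivity), Pi.smul_apply, smul_eq_mul]
  simp only [ContinuousAlgEquiv.refl_apply, Units.val_mk0, abs_pow, Nat.abs_cast,
    Complex.ofReal_pow, Complex.ofReal_natCast]
  rw [mul_assoc, mul_comm, ← zpow_natCast, ← zpow_mul, ← zpow_add₀ hn0]
  congr 2
  push_cast
  ring

/-- The Petersson integrand of `f` against its translate by a matrix of determinant `n`. -/
def kernel (A : FixedDetMatrix (Fin 2) ℤ n) (z : ℍ) : ℂ :=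
  petersson k f ((f : ℍ → ℂ) ∣[k] toGL A) z

lemma kernel_smul (g : SL(2, ℤ)) (A : FixedDetMatrix (Fin 2) ℤ n) (z : ℍ) :
    kernel f (g • A) z = kernel f A z := by
  rw [kernel, toGL_smul, SlashAction.slash_mul, slash_SL_eq, kernel]

/-- Slash both arguments by adj A: since A · adj A = n, the second becomes n^(k-2) f, and this
scalar cancels the one in `petersson_slash`. Conjugation then swaps the arguments. -/
lemma kernel_adjugate (A : FixedDetMatrix (Fin 2) ℤ n) (z : ℍ) :
    kernel f A (toGL (adjugateEquiv n A) • z) = conj (kernel f (adjugateEquiv n A) z) := by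
  have h := petersson_slash k f ((f : ℍ → ℂ) ∣[k] toGL A) (toGL (adjugateEquiv n A)) z
  rw [← SlashAction.slash_mul, toGL_mul_toGL_adjugate, slash_scalar, det_toGL, σ,
    if_pos (det_toGL_pos _)] at h
  have hn0 : (n : ℂ) ^ (k - 2) ≠ 0 := zpow_ne_zero _ natCast_ne_zero_of_neZero
  rw [kernel, kernel, ← petersson_symm]
  refine mul_left_cancel₀ hn0 ?_
  simp only [Nat.abs_cast, Complex.ofReal_natCast, ContinuousAlgEquiv.refl_apply] at h
  rw [← h, petersson, petersson, Pi.smul_apply, smul_eq_mul]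
  ring

/-- The squared norm factors into Petersson functions of f and of its slash by A, each bounded
uniformly in A because f is cuspidal. -/
lemma exists_norm_kernel_le : ∃ C : ℝ, ∀ (A : FixedDetMatrix (Fin 2) ℤ n) (z : ℍ),
    ‖kernel f A z‖ ≤ C := by
  obtain ⟨C, hC⟩ := CuspFormClass.petersson_bounded_left k 𝒮ℒ f f
  have hC0 : 0 ≤ C := (norm_nonneg _).trans (hC I)
  refine ⟨1 + C * ((n : ℝ) ^ (k - 2) * C), fun A z => ?_⟩
  have h1 : ‖kernel f A z‖ ^ 2 = ‖petersson k f f z‖ *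
      ‖petersson k ((f : ℍ → ℂ) ∣[k] toGL A) ((f : ℍ → ℂ) ∣[k] toGL A) z‖ := by
    simp only [kernel, petersson, norm_mul, Complex.norm_conj]
    ring
  have h2 : ‖petersson k ((f : ℍ → ℂ) ∣[k] toGL A) ((f : ℍ → ℂ) ∣[k] toGL A) z‖ ≤
      (n : ℝ) ^ (k - 2) * C := by
    rw [petersson_slash, det_toGL, norm_mul, norm_σ]
    have h3 : ‖(((|(n : ℝ)| : ℝ) : ℂ)) ^ (k - 2)‖ = (n : ℝ) ^ (k - 2) := by
      simp
    rw [h3]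
    gcongr
    exact hC _
  have h3 : ‖kernel f A z‖ ^ 2 ≤ C * ((n : ℝ) ^ (k - 2) * C) := by
    rw [h1]
    gcongr
    exact hC _
  nlinarith [sq_nonneg (‖kernel f A z‖ - 1)]

lemma continuous_kernel (A : FixedDetMatrix (Fin 2) ℤ n) : Continuous (kernel f A) := by
  have hf : Continuous f := (CuspFormClass.holo f).continuous
  refine petersson_continuous k hf ?_
  have h : ((f : ℍ → ℂ) ∣[k] toGL A) = fun z => f (toGL A • z) *
      ((n : ℂ) ^ (k - 1)) * (denom (toGL A) z) ^ (-k) := by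
    ext z
    rw [ModularForm.slash_apply, σ, if_pos (det_toGL_pos _), det_toGL]
    simp
  rw [h]
  refine ((hf.comp (continuous_const_smul _)).mul continuous_const).mul ?_
  refine Continuous.zpow₀ ?_ _ fun z => Or.inl (denom_ne_zero _ z)
  simp only [denom]
  fun_prop

lemma hasSum_prod_of_fintype {ι G M : Type*} [Fintype ι] [AddCommMonoid M] [TopologicalSpace M]
    [ContinuousAdd M] {g : ι → G → M} {s : ι → M} (hg : ∀ i, HasSum (g i) (s i)) :
    HasSum (fun p : ι × G => g p.1 p.2) (∑ i, s i) := by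
  classical
  have h : ∀ i ∈ univ, HasSum (fun p : ι × G => if p.1 = i then g i p.2 else 0) (s i) := by
    intro i _
    have hinj : Injective fun x : G => (i, x) := Prod.mk_right_injective i
    refine (hinj.hasSum_iff ?_).1 ?_
    · rintro ⟨j, x⟩ hx
      rw [if_neg]
      rintro rfl
      exact hx ⟨x, rfl⟩
    · simpa [comp_def] using hg i
  have h1 := hasSum_sum h
  convert h1 using 2 with p
  simp

end HeckeSums

/-! ### Self-adjointness of the Hecke operators. -/

namespace HeckeSums

open Finset UpperHalfPlane Function MeasureTheory ModularGroup FixedDetMatrices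
open scoped Modular ENNReal ModularForm ComplexConjugate

variable {n : ℕ} [NeZero n] {k : ℤ} (f : CuspForm 𝒮ℒ k) {χ : ℍ → ℝ}

/-- Unfolding: the sum over all matrices of determinant `n` collapses to the Hecke operator. -/
lemma tsum_integral_kernel (hmeas : Measurable χ) (h0 : ∀ z, 0 ≤ χ z) (h1 : ∀ z, χ z ≤ 1)
    (hfd : ∀ z, z ∉ 𝒟 → χ z = 0) (hsum : ∀ z, HasSum (fun g : SL(2, ℤ) => χ (g • z)) 1) :
    ∑' A : FixedDetMatrix (Fin 2) ℤ n, ∫ z, (χ z * χ (toGL A • z) : ℝ) * kernel f A z =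
      ∫ z, (χ z : ℂ) * petersson k f (heckeOperator k n f) z := by
  have hn : n ≠ 0 := NeZero.ne n
  have hcoset : ∀ (p : CosetIndex n × SL(2, ℤ)) (z : ℍ),
      toGL (cosetEquiv hn p) • z = p.2 • toGL (cosetRep p.1) • z := by
    intro p z
    change toGL (p.2 • cosetRep p.1) • z = _
    rw [toGL_smul, mul_smul]
    rfl
  have hker : ∀ (p : CosetIndex n × SL(2, ℤ)) (z : ℍ),
      kernel f (cosetEquiv hn p) z = kernel f (cosetRep p.1) z := fun p z => kernel_smul f _ _ z
  have hpt : ∀ z, ∑' A : FixedDetMatrix (Fin 2) ℤ n, (χ z * χ (toGL A • z) : ℝ) * kernel f A z =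
      (χ z : ℂ) * petersson k f (heckeOperator k n f) z := by
    intro z
    have hs : HasSum (fun p : CosetIndex n × SL(2, ℤ) =>
        (χ z * kernel f (cosetRep p.1) z) * ((χ (p.2 • toGL (cosetRep p.1) • z) : ℝ) : ℂ))
        (∑ i : CosetIndex n, (χ z * kernel f (cosetRep i) z) * ((1 : ℝ) : ℂ)) :=
      hasSum_prod_of_fintype (g := fun i (g : SL(2, ℤ)) => (χ z * kernel f (cosetRep i) z) *
          ((χ (g • toGL (cosetRep i) • z) : ℝ) : ℂ))
        fun i => (Complex.hasSum_ofReal.2 (hsum (toGL (cosetRep i) • z))).mul_left _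
    rw [← (cosetEquiv hn).tsum_eq]
    have he : (fun p => ((χ z * χ (toGL (cosetEquiv hn p) • z) : ℝ) : ℂ) *
        kernel f (cosetEquiv hn p) z) = fun p : CosetIndex n × SL(2, ℤ) =>
        (χ z * kernel f (cosetRep p.1) z) * ((χ (p.2 • toGL (cosetRep p.1) • z) : ℝ) : ℂ) := by
      ext p
      rw [hcoset, hker]
      push_cast
      ring
    rw [he, hs.tsum_eq]
    simp only [Complex.ofReal_one, mul_one, ← mul_sum]
    congr 1
    simp only [kernel, petersson, ← sum_slash_cosetRep, ← mul_sum, ← sum_mul]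
  rw [← integral_tsum]
  · exact integral_congr_ae (Filter.Eventually.of_forall hpt)
  · intro A
    have hA : Measurable fun z : ℍ => toGL A • z := (continuous_const_smul _).measurable
    exact ((Complex.measurable_ofReal.comp (hmeas.mul (hmeas.comp hA))).mul
      (continuous_kernel f A).measurable).aestronglyMeasurable
  · obtain ⟨C, hC⟩ := exists_norm_kernel_le f (n := n)
    rw [← lintegral_tsum]
    -- For each representative the χ-values over SL(2, ℤ) sum to 1, so on 𝒟 the norms total at most
    -- C times the number of representatives. Finite volume then justifies interchanging sum and
    -- integral.
    · have hbound : ∀ z, ∑' A : FixedDetMatrix (Fin 2) ℤ n,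
          ‖((χ z * χ (toGL A • z) : ℝ) : ℂ) * kernel f A z‖ₑ ≤
          (𝒟 : Set ℍ).indicator (fun _ => ∑ _i : CosetIndex n, ENNReal.ofReal C) z := by
        intro z
        by_cases hz : z ∈ 𝒟
        · rw [Set.indicator_of_mem hz, ← (cosetEquiv hn).tsum_eq]
          have hs : HasSum (fun p : CosetIndex n × SL(2, ℤ) =>
              ENNReal.ofReal C * ENNReal.ofReal (χ (p.2 • toGL (cosetRep p.1) • z)))
              (∑ _i : CosetIndex n, ENNReal.ofReal C * ENNReal.ofReal 1) := by
            refine hasSum_prod_of_fintype (g := fun i (g : SL(2, ℤ)) =>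
              ENNReal.ofReal C * ENNReal.ofReal (χ (g • toGL (cosetRep i) • z))) fun i => ?_
            have h := hsum (toGL (cosetRep i) • z)
            rw [← h.tsum_eq, ENNReal.ofReal_tsum_of_nonneg (fun _ => h0 _) h.summable,
              ← ENNReal.tsum_mul_left]
            exact ENNReal.summable.hasSum
          simp only [ENNReal.ofReal_one, mul_one] at hs
          rw [← hs.tsum_eq]
          refine ENNReal.tsum_le_tsum fun p => ?_
          rw [hcoset, hker, enorm_mul, mul_comm, ← ofReal_norm, ← ofReal_norm, Complex.norm_real,
            Real.norm_of_nonneg (mul_nonneg (h0 _) (h0 _))]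
          gcongr
          · exact hC _ _
          · exact mul_le_of_le_one_left (h0 _) (h1 _)
        · simp [hfd z hz]
      refine ((lintegral_mono hbound).trans_lt ?_).ne
      rw [lintegral_indicator isClosed_fd.measurableSet, setLIntegral_const]
      exact ENNReal.mul_lt_top (ENNReal.sum_lt_top.2 fun _ _ => ENNReal.ofReal_lt_top) volume_fd_lt_top
    · intro A
      have hA : Measurable fun z : ℍ => toGL A • z := (continuous_const_smul _).measurable
      exact ((Complex.measurable_ofReal.comp (hmeas.mul (hmeas.comp hA))).mul
        (continuous_kernel f A).measurable).enorm.aemeasurable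

/-- The sum over all matrices of determinant `n` is symmetric under passage to the adjugate. -/
lemma conj_tsum_integral_kernel (χ : ℍ → ℝ) :
    conj (∑' A : FixedDetMatrix (Fin 2) ℤ n, ∫ z, (χ z * χ (toGL A • z) : ℝ) * kernel f A z) =
      ∑' A : FixedDetMatrix (Fin 2) ℤ n, ∫ z, (χ z * χ (toGL A • z) : ℝ) * kernel f A z := by
  rw [Complex.conj_tsum, ← (adjugateEquiv n).tsum_eq]
  refine tsum_congr fun A => ?_
  set B := adjugateEquiv n A with hB
  rw [← integral_conj]
  symm
  -- Substituting z ↦ Bz swaps the two χ-factors, because AB is scalar and acts trivially.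
  have hmp := measurePreserving_smul (toGL B) (volume : Measure ℍ)
  rw [← hmp.integral_comp (MeasurableEquiv.smul (toGL B)).measurableEmbedding]
  refine integral_congr_ae (Filter.Eventually.of_forall fun z => ?_)
  have hAB : toGL A • toGL B • z = z := by
    rw [← mul_smul, hB, toGL_mul_toGL_adjugate, glScalar_smul]
  simp only
  rw [hAB, kernel_adjugate, map_mul, Complex.conj_ofReal, mul_comm (χ z)]

/-- If it vanished, χ(gz)|f(z)|² y^k would be zero almost everywhere for all g at once, by
invariance and countability. Summing over g gives f = 0 almost everywhere, contradicting continuity.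
-/
lemma integral_petersson_self_ne_zero (hf : (f : ℍ → ℂ) ≠ 0) (hmeas : Measurable χ)
    (h0 : ∀ z, 0 ≤ χ z) (h1 : ∀ z, χ z ≤ 1) (hfd : ∀ z, z ∉ 𝒟 → χ z = 0)
    (hsum : ∀ z, HasSum (fun g : SL(2, ℤ) => χ (g • z)) 1) :
    ∫ z, χ z * (‖f z‖ ^ 2 * z.im ^ k) ≠ 0 := by
  have hfc : Continuous f := (CuspFormClass.holo f).continuous
  have hPc : Continuous fun z : ℍ => ‖f z‖ ^ 2 * z.im ^ k :=
    (hfc.norm.pow 2).mul (continuous_im.zpow₀ k fun z => Or.inl z.im_ne_zero)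
  have hnorm : ∀ z : ℍ, ‖petersson k f f z‖ = ‖f z‖ ^ 2 * z.im ^ k := by
    intro z
    simp only [petersson, norm_mul, Complex.norm_conj, norm_zpow, Complex.norm_real,
      Real.norm_of_nonneg z.im_pos.le]
    ring
  have hP0 : ∀ z : ℍ, 0 ≤ ‖f z‖ ^ 2 * z.im ^ k := fun z => hnorm z ▸ norm_nonneg _
  obtain ⟨C, hC⟩ := CuspFormClass.petersson_bounded_left k 𝒮ℒ f f
  have hint : Integrable fun z : ℍ => χ z * (‖f z‖ ^ 2 * z.im ^ k) := by
    refine Integrable.mono' (g := (𝒟 : Set ℍ).indicator fun _ => C)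
      ((integrable_indicator_iff isClosed_fd.measurableSet).2
        (integrableOn_const volume_fd_lt_top.ne))
      (hmeas.mul hPc.measurable).aestronglyMeasurable (Filter.Eventually.of_forall fun z => ?_)
    rw [Real.norm_of_nonneg (mul_nonneg (h0 z) (hP0 z))]
    by_cases hz : z ∈ 𝒟
    · rw [Set.indicator_of_mem hz]
      exact (mul_le_of_le_one_left (hP0 z) (h1 z)).trans (hnorm z ▸ hC z)
    · simp [hfd z hz, hz]
  intro hzero
  rw [integral_eq_zero_iff_of_nonneg (fun z => mul_nonneg (h0 z) (hP0 z)) hint] at hzero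
  have hall : ∀ᵐ z : ℍ, ∀ g : SL(2, ℤ), χ (g • z) * (‖f z‖ ^ 2 * z.im ^ k) = 0 := by
    rw [ae_all_iff]
    intro g
    have hmp := measurePreserving_smul (g : GL (Fin 2) ℝ) (volume : Measure ℍ)
    filter_upwards [hmp.quasiMeasurePreserving.ae hzero] with z hz
    rw [← hnorm, ← SlashInvariantFormClass.petersson_smul (Γ := 𝒮ℒ) (f := f) (f' := f) ⟨g, rfl⟩,
      hnorm]
    exact hz
  have hae : ∀ᵐ z : ℍ, f z = 0 := by
    filter_upwards [hall] with z hz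
    have hs := (hsum z).mul_right (‖f z‖ ^ 2 * z.im ^ k)
    simp only [hz, one_mul] at hs
    have h2 := hs.unique hasSum_zero
    rcases mul_eq_zero.1 h2 with h3 | h3
    · exact norm_eq_zero.1 (pow_eq_zero_iff (by norm_num) |>.1 h3)
    · exact absurd h3 (zpow_ne_zero _ z.im_ne_zero)
  apply hf
  by_contra hne
  obtain ⟨z, hz⟩ := Function.ne_iff.1 hne
  have hopen : IsOpen {z : ℍ | f z ≠ 0} := isOpen_ne_fun hfc continuous_const
  exact (volume_pos_of_isOpen hopen ⟨z, hz⟩).ne' (ae_iff.1 hae)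

variable {f}

/-- Eigenvalues of Hecke operators on cusp forms are real. -/
theorem conj_eq_of_heckeOperator_eq (hf : (f : ℍ → ℂ) ≠ 0) {μ : ℂ}
    (hμ : ∀ z : ℍ, heckeOperator k n f z = μ * f z) : conj μ = μ := by
  obtain ⟨χ, hmeas, h0, h1, hfd, hsum⟩ := exists_partition_of_unity
  have hne := integral_petersson_self_ne_zero f hf hmeas h0 h1 hfd hsum
  have hI := tsum_integral_kernel (n := n) f hmeas h0 h1 hfd hsum
  have hpt : ∀ z : ℍ, (χ z : ℂ) * petersson k f (heckeOperator k n f) z =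
      μ * ((χ z * (‖f z‖ ^ 2 * z.im ^ k) : ℝ) : ℂ) := by
    intro z
    rw [petersson, hμ]
    have := Complex.conj_mul' (f z)
    push_cast
    linear_combination (χ z : ℂ) * μ * (z.im : ℂ) ^ k * this
  simp_rw [hpt] at hI
  rw [integral_const_mul, integral_complex_ofReal] at hI
  have hconj := conj_tsum_integral_kernel (n := n) f χ
  rw [hI, map_mul, Complex.conj_ofReal] at hconj
  exact mul_right_cancel₀ (by exact_mod_cast hne) hconj

end HeckeSums

/-! ### Real, Hecke multiplicative eigenvalues. -/

namespace HeckeSums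

open UpperHalfPlane
open scoped ComplexConjugate

variable {k : ℤ} {f : CuspForm 𝒮ℒ k}

namespace IsHeckeCuspForm

lemma coe_ne_zero (hf : IsHeckeCuspForm f) : (f : ℍ → ℂ) ≠ 0 := by
  intro h
  have h1 := hf.coeff_one
  rw [h, qExpansion_zero] at h1
  simp at h1

lemma ofReal_re_lam (hf : IsHeckeCuspForm f) {n : ℕ} (hn : 1 ≤ n) : ((lam f n).re : ℂ) = lam f n := by
  have : NeZero n := ⟨by omega⟩
  rw [← Complex.conj_eq_iff_re, lam, map_div₀, Complex.conj_ofReal,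
    conj_eq_of_heckeOperator_eq hf.coe_ne_zero (hf.heckeOperator_eq hn)]

lemma isHeckeMultiplicative (hf : IsHeckeCuspForm f) : IsHeckeMultiplicative fun n => (lam f n).re where
  map_one := by simp [hf.lam_one]
  map_mul m n hm hn hmn := by
    rw [hf.lam_mul hm hmn, ← hf.ofReal_re_lam hm, ← hf.ofReal_re_lam hn, ← Complex.ofReal_mul]
    simp
  map_prime_pow p j hp := by
    have h := hf.lam_prime_mul_lam_pow hp j
    rw [← hf.ofReal_re_lam hp.one_le, ← hf.ofReal_re_lam (Nat.one_le_pow (j + 1) p hp.pos)] at h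
    have h1 := congrArg Complex.re h
    rwa [← Complex.ofReal_mul, Complex.ofReal_re, Complex.add_re] at h1

lemma heckeSum_eq (hf : IsHeckeCuspForm f) (x : ℝ) :
    heckeSum f x = ((∑ n ∈ Finset.Icc 1 ⌊x⌋₊, (lam f n).re : ℝ) : ℂ) := by
  rw [heckeSum, Complex.ofReal_sum]
  exact Finset.sum_congr rfl fun n hn => (hf.ofReal_re_lam (Finset.mem_Icc.1 hn).1).symm

end IsHeckeCuspForm

end HeckeSums

end

/-! ### The two assertions. -/

theorem theorem1 :
    (∃ c₀ : ℝ, 0 < c₀ ∧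
      ∀ (k : ℤ), 0 < k → Even k →
      ∀ (f : CuspForm 𝒮ℒ k), HeckeSums.IsHeckeCuspForm f →
      ∀ (x : ℝ), 2 ≤ x →
        (∀ n : ℕ, 1 ≤ n → (n : ℝ) ≤ x → 0 ≤ HeckeSums.lam f n) →
        ((c₀ * (x * Real.log x) : ℝ) : ℂ) ≤ HeckeSums.heckeSum f x) ∧
    (∀ (k : ℕ → ℤ), (∀ j, 0 < k j) → (∀ j, Even (k j)) →
      ∀ (f : (j : ℕ) → CuspForm 𝒮ℒ (k j)), (∀ j, HeckeSums.IsHeckeCuspForm (f j)) →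
      ∀ (x : ℕ → ℝ), (∀ j, 2 ≤ x j) →
        (fun j => HeckeSums.heckeSum (f j) (x j)) =o[Filter.atTop]
          (fun j => x j * Real.log (x j)) →
        ∀ᶠ j in Filter.atTop,
          ∃ N : ℕ, HeckeSums.IsFirstNegative (f j) N ∧ (N : ℝ) ≤ x j) := by
  obtain ⟨c, hc, hmain⟩ := HeckeSums.exists_le_sum_of_nonneg
  refine ⟨⟨c, hc, fun k _ _ f hf x hx hpos => ?_⟩, fun k _ _ f hf x hx ho => ?_⟩
  · rw [hf.heckeSum_eq, Complex.real_le_real]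
    exact hmain _ hf.isHeckeMultiplicative x hx fun n hn hnx =>
      (Complex.nonneg_iff.1 (hpos n hn hnx)).1
  · classical
    -- With c/2 as the little-o constant, a sum of at least c x log x is impossible.
    filter_upwards [ho.bound (half_pos hc)] with j hj
    have hex : ∃ n : ℕ, (1 ≤ n ∧ HeckeSums.lam (f j) n < 0) ∧ (n : ℝ) ≤ x j := by
      by_contra! hcon
      have hpos : ∀ n : ℕ, 1 ≤ n → (n : ℝ) ≤ x j → 0 ≤ (HeckeSums.lam (f j) n).re := by
        intro n hn hnx
        by_contra! hneg
        refine absurd hnx (not_le.2 (hcon n ⟨hn, ?_⟩))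
        -- The complex order requires a real value, so a negative real part alone would not suffice.
        rw [← (hf j).ofReal_re_lam hn]
        exact_mod_cast hneg
      have h1 := hmain _ (hf j).isHeckeMultiplicative (x j) (hx j) hpos
      have hlog : 0 < x j * Real.log (x j) :=
        mul_pos (by linarith [hx j]) (Real.log_pos (by linarith [hx j]))
      rw [(hf j).heckeSum_eq, Complex.norm_real, Real.norm_of_nonneg hlog.le] at hj
      nlinarith [Real.le_norm_self (∑ n ∈ Finset.Icc 1 ⌊x j⌋₊, (HeckeSums.lam (f j) n).re),
        mul_pos hc hlog]
    obtain ⟨n, hn, hnx⟩ := hex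
    have hex' : ∃ n : ℕ, 1 ≤ n ∧ HeckeSums.lam (f j) n < 0 := ⟨n, hn⟩
    exact ⟨Nat.find hex', ⟨Nat.find_spec hex', fun m hm => Nat.find_min' hex' hm⟩,
      le_trans (by exact_mod_cast Nat.find_min' hex' hn) hnx⟩
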